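/- For integers $m,n\ge 1$ let $\check G_{m,n}$ be the plane crossed quadratic lattice graph: the grid graph with $m+1$ rows and $n+1$ columns of vertices, with both diagonals added in each square inner face. Let $\check H_{n,m}$ (cylinder, $(m+1)n$ vertices) be obtained from $\check G_{m,n}$ by identifying its left column with its right column, and let $\check S_{n,m}$ (torus, $mn$ vertices) be obtained from $\check H_{n,m}$ by identifying its top row with its bottom row. For a finite graph $G$ let $i(G)$ be its number of independent sets and $|V(G)|$ its number of vertices. Let $P_m$ be the set of $0$-$1$ vectors of length $m+1$ without two consecutive $1$'s, and $C_n$ the set of $0$-$1$ vectors of length $n$ without two cyclically consecutive $1$'s. Let $T_m$ (rows and columns indexed by $P_m$) be the transfer matrix of $\check G_{m,n}$: its $(u,v)$ entry is $1$ if there are no positions $i,j$ with $u_i=v_j=1$ and $|i-j|\le 1$, and is $0$ otherwise. Let $B_n$ (rows and columns indexed by $C_n$) be the transfer matrix of $\check H_{n,m}$: its $(u,v)$ entry is $1$ if there are no positions $i,j$ that are equal or cyclically consecutive modulo $n$ with $u_i=v_j=1$, and is $0$ otherwise. Let $\lambda_m$ and $\xi_n$ be the largest eigenvalues of the real symmetric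 matrices $T_m$ and $B_n$. Then there is a real number $\eta$, the entropy constant of the crossed quadratic lattice, such that the following double limits exist and are all equal to $\eta$: $$\eta=\lim_{m,n\to\infty} i(\check G_{m,n})^{1/|V(\check G_{m,n})|}=\lim_{m,n\to\infty} i(\check H_{n,m})^{1/|V(\check H_{n,m})|}=\lim_{m,n\to\infty} i(\check S_{n,m})^{1/|V(\check S_{n,m})|}=\lim_{m,n\to\infty} i(\check G_{m,n})^{1/(mn)}.$$ Moreover, for all integers $p,q,k\ge 1$, $$\Bigl(\frac{\lambda_{p+2q}}{\lambda_{2q}}\Bigr)^{1/p}\le \eta\le (\xi_{2k})^{1/(2k)},$$ and for $p=q=4$ and $k=6$ these two bounds have the decimal expansions $$\Bigl(\frac{\lambda_{12}}{\lambda_{8}}\Bigr)^{1/4}=1.342542258\ldots,\qquad (\xi_{12})^{1/12}=1.342652572\ldots,$$ that is, they lie in $[1.342542258,\,1.342542259)$ and in $[1.342652572,\,1.342652573)$; so $1.342542258\ldots\le\eta\le 1.342652572\ldots$. -/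

import Mathlib

open Filter Topology

namespace CrossedLattice

/-- The plane quadratic lattice graph with `m + 1` rows and `n + 1` columns. -/
def quadraticLattice (m n : ℕ) : SimpleGraph (Fin (m + 1) × Fin (n + 1)) :=
  (SimpleGraph.pathGraph (m + 1)).boxProd (SimpleGraph.pathGraph (n + 1))

/-- The two crossed diagonals of every square inner face. -/
def faceDiagonals (m n : ℕ) : SimpleGraph (Fin (m + 1) × Fin (n + 1)) :=
  SimpleGraph.fromRel fun x y =>
    (x.1 : ℕ) + 1 = y.1 ∧ ((x.2 : ℕ) + 1 = y.2 ∨ (y.2 : ℕ) + 1 = x.2)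

/-- The plane crossed quadratic lattice graph with `m + 1` rows and `n + 1` columns. -/
def planeCrossed (m n : ℕ) : SimpleGraph (Fin (m + 1) × Fin (n + 1)) :=
  quadraticLattice m n ⊔ faceDiagonals m n

/-- The cylindrical crossed lattice graph: the plane graph with its left column (index `0`)
identified with its right column (index `n`). It has `m + 1` rows and, for `n ≥ 1`, `n` columns. -/
def cylinderCrossed (m n : ℕ) : SimpleGraph (Fin (m + 1) × ZMod n) :=
  (planeCrossed m n).map fun x => (x.1, ((x.2 : ℕ) : ZMod n))

/-- The toroidal crossed lattice graph: the cylindrical graph with its top row (index `0`)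
identified with its bottom row (index `m`). -/
def torusCrossed (m n : ℕ) : SimpleGraph (ZMod m × ZMod n) :=
  (cylinderCrossed m n).map fun x => (((x.1 : ℕ) : ZMod m), x.2)

/-- The number of independent sets of a graph. -/
noncomputable def numIndepSets {V : Type*} (G : SimpleGraph V) : ℕ :=
  Nat.card {S : Set V // G.IsIndepSet S}

/-- The number of independent sets of a graph, to the power one over the number of vertices. -/
noncomputable def indepRoot {V : Type*} (G : SimpleGraph V) : ℝ :=
  (numIndepSets G : ℝ) ^ (1 / (Nat.card V : ℝ))

/-- The `0`-`1` vectors of length `m + 1` without two consecutive `1`s. -/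
abbrev PathVec (m : ℕ) : Type :=
  {v : Fin (m + 1) → Bool //
    ∀ i j : Fin (m + 1), (i : ℕ) + 1 = j → ¬(v i = true ∧ v j = true)}

/-- The `0`-`1` vectors of length `n` without two consecutive `1`s in cyclic order. -/
abbrev CycleVec (n : ℕ) : Type :=
  {v : Fin n → Bool //
    ∀ i j : Fin n, ((i : ℕ) + 1) % n = j → ¬(v i = true ∧ v j = true)}

/-- The transfer matrix `T_m` of the plane crossed lattice: the entry at `(u, v)` is `1` if `u`
and `v` can be neighbouring columns of an independent set, and `0` otherwise. -/
def transferT (m : ℕ) : Matrix (PathVec m) (PathVec m) ℝ :=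
  Matrix.of fun u v =>
    if ∀ i j : Fin (m + 1), ((i : ℕ) = j ∨ (i : ℕ) + 1 = j ∨ (j : ℕ) + 1 = i) →
      ¬(u.1 i = true ∧ v.1 j = true) then 1 else 0

/-- The transfer matrix `B_n` of the cylindrical crossed lattice of circumference `n`: the entry
at `(u, v)` is `1` if `u` and `v` can be neighbouring rows of an independent set, and `0`
otherwise. -/
def transferB (n : ℕ) : Matrix (CycleVec n) (CycleVec n) ℝ :=
  Matrix.of fun u v =>
    if ∀ i j : Fin n, ((i : ℕ) = j ∨ ((i : ℕ) + 1) % n = j ∨ ((j : ℕ) + 1) % n = i) →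
      ¬(u.1 i = true ∧ v.1 j = true) then 1 else 0

/-- The largest real eigenvalue of a square real matrix. -/
noncomputable def largestEigenvalue {ι : Type*} [Fintype ι] [DecidableEq ι]
    (A : Matrix ι ι ℝ) : ℝ :=
  sSup {x : ℝ | Module.End.HasEigenvalue (Matrix.toLin' A) x}

/-- A nonempty real symmetric matrix has a largest eigenvalue, and `largestEigenvalue` is it. -/
theorem isGreatest_largestEigenvalue {ι : Type*} [Fintype ι] [DecidableEq ι] [Nonempty ι]
    {A : Matrix ι ι ℝ} (hA : A.IsSymm) :
    IsGreatest {x : ℝ | Module.End.HasEigenvalue (Matrix.toLin' A) x} (largestEigenvalue A) := by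
  have hH : A.IsHermitian := by
    rw [Matrix.IsHermitian, Matrix.conjTranspose_eq_transpose_of_trivial]
    exact hA
  have hS : {x : ℝ | Module.End.HasEigenvalue (Matrix.toLin' A) x} = spectrum ℝ A := by
    ext x
    rw [Set.mem_ofPred_eq, Module.End.hasEigenvalue_iff_mem_spectrum, Matrix.spectrum_toLin']
  have hne : (spectrum ℝ A).Nonempty :=
    ⟨_, hH.eigenvalues_mem_spectrum_real (Classical.arbitrary ι)⟩
  have hfin : (spectrum ℝ A).Finite := Matrix.finite_real_spectrum
  rw [largestEigenvalue, hS]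
  exact ⟨hne.csSup_mem hfin, fun x hx => le_csSup hfin.bddAbove hx⟩

theorem transferT_isSymm (m : ℕ) : (transferT m).IsSymm := by
  ext u v
  simp only [transferT, Matrix.transpose_apply, Matrix.of_apply]
  refine if_congr ⟨fun h i j hij => ?_, fun h i j hij => ?_⟩ rfl rfl <;>
    · rw [and_comm]
      exact h j i (by tauto)

theorem transferB_isSymm (n : ℕ) : (transferB n).IsSymm := by
  ext u v
  simp only [transferB, Matrix.transpose_apply, Matrix.of_apply]
  refine if_congr ⟨fun h i j hij => ?_, fun h i j hij => ?_⟩ rfl rfl <;>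
    · rw [and_comm]
      exact h j i (by tauto)

instance (m : ℕ) : Nonempty (PathVec m) := ⟨⟨fun _ => false, by simp⟩⟩

instance (n : ℕ) : Nonempty (CycleVec n) := ⟨⟨fun _ => false, by simp⟩⟩

/-- `λ_m`, the largest eigenvalue of `T_m`. -/
noncomputable def lam (m : ℕ) : ℝ := largestEigenvalue (transferT m)

/-- `ξ_n`, the largest eigenvalue of `B_n`. -/
noncomputable def xi (n : ℕ) : ℝ := largestEigenvalue (transferB n)

theorem isGreatest_lam (m : ℕ) :
    IsGreatest {x : ℝ | Module.End.HasEigenvalue (Matrix.toLin' (transferT m)) x} (lam m) :=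
  isGreatest_largestEigenvalue (transferT_isSymm m)

theorem isGreatest_xi (n : ℕ) :
    IsGreatest {x : ℝ | Module.End.HasEigenvalue (Matrix.toLin' (transferB n)) x} (xi n) :=
  isGreatest_largestEigenvalue (transferB_isSymm n)

end CrossedLattice

/-!
The count of independent sets of the `(m + 1) × (n + 1)` crossed lattice is the sum of the entries
of `transferT m ^ n`, because an independent set is a walk of its columns
(`numIndepSets_planeCrossed`), and it is symmetric in `m` and `n`.

*Existence of the entropy.* Restricting independent sets to translates of a fixed block that cover
the lattice makes the logarithm of the count submultiplicative in both directions, so its quotient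
by the number of vertices tends to its infimum (`tendsto_logCount_div`). The counts on the cylinder
and the torus lie between those of the plane lattices of sizes `(m - 2, n - 2)` and `(m, n)`:
pulling back along the identifications is injective, and leaving two rows and columns empty cuts
the torus open. Hence all four limits agree (`tendsto_rpow_of_squeeze`).

*Bounds.* A symmetric nonnegative matrix with a positive row has a positive eigenvector for its
largest eigenvalue (`exists_pos_eigenvector`). Consequently the entry sum of its `n`-th power grows
exactly like the `n`-th power of that eigenvalue, and `log (lam m) / m` tends to `log η`. For the
upper bound, `lam m ^ (2 * k)` is at most the trace of `transferT m ^ (2 * k)`, which counts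
configurations on a cylinder of circumference `2 * k`, and these are walks of length `m` of
`transferB (2 * k)` (`trace_transferT_pow_le`). For the lower bound, the Rayleigh quotient of
`transferT m ^ p` at `transferT m ^ q 1` is the ratio of the counts for widths `p + 2 * q` and
`2 * q` (`logCount_sub_le`). In both cases `m` tends to infinity.

*Numerical values.* If `x` is a positive vector, the largest eigenvalue of `A` lies between the
minimum and the maximum of the ratios of the entries of `A x` and `x` (Collatz–Wielandt). With `x`
obtained by power iteration from the all-ones vector, this is a computation with natural numbers.
It is carried out on vectors stored as nested pairs along the Fibonacci recursion `w = 0w'` or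
`w = 10w'` of the index words, on which the transfer matrices act recursively
(`FibVec.isTransfer_add_two`, `CycleFibVec.transferThen_spec`).
-/

namespace CrossedLattice

open scoped Matrix

/-! ### Perron eigenvectors of symmetric nonnegative matrices -/

section Perron

variable {ι : Type*} [Fintype ι] {A : Matrix ι ι ℝ} {w : ι → ℝ} {c : ℝ}

theorem posSemidef_largestEigenvalue_sub [DecidableEq ι] [Nonempty ι] (hA : A.IsSymm) :
    (algebraMap ℝ (Matrix ι ι ℝ) (largestEigenvalue A) - A).PosSemidef := by
  have hH : A.IsHermitian := by
    rw [Matrix.IsHermitian, Matrix.conjTranspose_eq_transpose_of_trivial]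
    exact hA
  rw [Matrix.posSemidef_iff_isHermitian_and_spectrum_nonneg]
  refine ⟨?_, ?_⟩
  · refine Matrix.IsHermitian.sub ?_ hH
    rw [Algebra.algebraMap_eq_smul_one]
    simp [Matrix.IsHermitian]
  · rw [← spectrum.singleton_sub_eq]
    rintro x ⟨a, rfl, b, hb, rfl⟩
    have hb' : Module.End.HasEigenvalue (Matrix.toLin' A) b := by
      rwa [Module.End.hasEigenvalue_iff_mem_spectrum, Matrix.spectrum_toLin']
    have := (isGreatest_largestEigenvalue hA).2 hb'
    simpa using this

/-- Perron's theorem in the symmetric case, for a matrix with a positive row. The quadratic form of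
`λ - A` is nonnegative; passing from an eigenvector `v` of the largest eigenvalue `λ` to its
absolute value `|v|` can only decrease it, so it vanishes at `|v|`, which is therefore an
eigenvector too. -/
theorem exists_pos_eigenvector [DecidableEq ι] (hA : A.IsSymm) (hA0 : ∀ i j, 0 ≤ A i j)
    (o : ι) (ho : ∀ j, 0 < A o j) :
    0 < largestEigenvalue A ∧
      ∃ w : ι → ℝ, (∀ i, 0 < w i) ∧ A *ᵥ w = largestEigenvalue A • w := by
  have : Nonempty ι := ⟨o⟩
  set c := largestEigenvalue A with hc
  obtain ⟨v, hv⟩ := (isGreatest_largestEigenvalue hA).1.exists_hasEigenvector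
  have hv0 : v ≠ 0 := hv.2
  have hAv : A *ᵥ v = c • v := by
    have := hv.apply_eq_smul
    rwa [Matrix.toLin'_apply] at this
  have hP := posSemidef_largestEigenvalue_sub hA
  rw [← hc] at hP
  have key : ∀ x : ι → ℝ, (algebraMap ℝ (Matrix ι ι ℝ) c - A) *ᵥ x = c • x - A *ᵥ x := by
    intro x
    rw [Matrix.sub_mulVec, Algebra.algebraMap_eq_smul_one, Matrix.smul_mulVec, Matrix.one_mulVec]
  set w : ι → ℝ := fun i => |v i| with hw
  have hw0 : ∀ i, 0 ≤ w i := fun i => abs_nonneg _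
  have hquad : v ⬝ᵥ (A *ᵥ v) ≤ w ⬝ᵥ (A *ᵥ w) := by
    simp only [dotProduct, Matrix.mulVec, Finset.mul_sum]
    refine Finset.sum_le_sum fun i _ => Finset.sum_le_sum fun j _ => ?_
    calc v i * (A i j * v j) ≤ |v i * (A i j * v j)| := le_abs_self _
      _ = w i * (A i j * w j) := by rw [abs_mul, abs_mul, abs_of_nonneg (hA0 i j)]
  have hself : w ⬝ᵥ w = v ⬝ᵥ v := by
    simp [dotProduct, hw]
  have hzero : star w ⬝ᵥ ((algebraMap ℝ (Matrix ι ι ℝ) c - A) *ᵥ w) = 0 := by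
    refine le_antisymm ?_ (hP.dotProduct_mulVec_nonneg w)
    rw [star_trivial, key, dotProduct_sub, dotProduct_smul, hself]
    rw [hAv, dotProduct_smul] at hquad
    linarith
  rw [hP.dotProduct_mulVec_zero_iff, key, sub_eq_zero] at hzero
  -- row `o` of `A w = c w` bounds `c * w o` below by a positive sum, so `c` and `w o` are positive
  obtain ⟨k, hk⟩ := Function.ne_iff.1 hv0
  have hrow : ∀ i, c * w i = ∑ j, A i j * w j := fun i => by
    have := congrFun hzero i
    simpa [Matrix.mulVec, dotProduct] using this
  have hco : 0 < c * w o := by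
    rw [hrow o]
    exact Finset.sum_pos' (fun j _ => mul_nonneg (hA0 _ _) (hw0 j))
      ⟨k, Finset.mem_univ _, mul_pos (ho k) (abs_pos.2 (by simpa using hk))⟩
  have hwo : 0 < w o := (hw0 o).lt_of_ne fun h => by simp [← h] at hco
  have hcpos : 0 < c := pos_of_mul_pos_left hco hwo.le
  refine ⟨hcpos, w, fun i => ?_, hzero.symm⟩
  have hci : 0 < c * w i := by
    rw [hrow i]
    refine Finset.sum_pos' (fun j _ => mul_nonneg (hA0 _ _) (hw0 j)) ⟨o, Finset.mem_univ _, ?_⟩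
    rw [← hA.apply]
    exact mul_pos (ho i) hwo
  exact pos_of_mul_pos_right hci hcpos.le

theorem pow_mulVec_of_mulVec_eq_smul [DecidableEq ι] (h : A *ᵥ w = c • w) (n : ℕ) :
    (A ^ n) *ᵥ w = c ^ n • w := by
  induction n with
  | zero => simp
  | succ n ih => rw [pow_succ, ← Matrix.mulVec_mulVec, h, Matrix.mulVec_smul, ih, smul_smul,
      pow_succ, mul_comm]

theorem pow_entry_nonneg [DecidableEq ι] (hA0 : ∀ i j, 0 ≤ A i j) (n : ℕ) :
    ∀ i j, 0 ≤ (A ^ n) i j := by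
  induction n with
  | zero =>
    intro i j
    rw [pow_zero, Matrix.one_apply]
    split_ifs <;> norm_num
  | succ n ih =>
    intro i j
    rw [pow_succ, Matrix.mul_apply]
    exact Finset.sum_nonneg fun k _ => mul_nonneg (ih i k) (hA0 k j)

/-- The sum of all entries of a matrix. -/
def entrySum (A : Matrix ι ι ℝ) : ℝ := ∑ i, ∑ j, A i j

/-- The entry sum of `A ^ n` is of the exact order `c ^ n` if `A` has a positive eigenvector with
eigenvalue `c`. -/
theorem exists_entrySum_pow_bounds [DecidableEq ι] [Nonempty ι] (hA0 : ∀ i j, 0 ≤ A i j)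
    (hw : ∀ i, 0 < w i) (h : A *ᵥ w = c • w) :
    ∃ a b : ℝ, 0 < a ∧ 0 < b ∧
      ∀ n : ℕ, a * c ^ n ≤ entrySum (A ^ n) ∧ entrySum (A ^ n) ≤ b * c ^ n := by
  obtain ⟨i₀, hi₀⟩ := Finite.exists_min w
  obtain ⟨i₁, hi₁⟩ := Finite.exists_max w
  have hs : 0 < ∑ i, w i := Finset.sum_pos (fun i _ => hw i) Finset.univ_nonempty
  refine ⟨(∑ i, w i) / w i₁, (∑ i, w i) / w i₀, div_pos hs (hw _), div_pos hs (hw _),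
    fun n => ?_⟩
  have hrow : c ^ n * ∑ i, w i = ∑ i, ∑ j, (A ^ n) i j * w j := by
    rw [Finset.mul_sum]
    refine Finset.sum_congr rfl fun i _ => ?_
    have := congrFun (pow_mulVec_of_mulVec_eq_smul h n) i
    simpa [Matrix.mulVec, dotProduct] using this.symm
  have hn := pow_entry_nonneg hA0 n
  constructor
  · rw [div_mul_eq_mul_div, div_le_iff₀ (hw _), mul_comm (∑ i, w i), hrow, entrySum,
      Finset.sum_mul]
    refine Finset.sum_le_sum fun i _ => ?_
    rw [Finset.sum_mul]
    exact Finset.sum_le_sum fun j _ => mul_le_mul_of_nonneg_left (hi₁ j) (hn i j)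
  · rw [div_mul_eq_mul_div, le_div_iff₀ (hw _), mul_comm (∑ i, w i), hrow, entrySum,
      Finset.sum_mul]
    refine Finset.sum_le_sum fun i _ => ?_
    rw [Finset.sum_mul]
    exact Finset.sum_le_sum fun j _ => mul_le_mul_of_nonneg_left (hi₀ j) (hn i j)

/-- The Schur test: a positive eigenvector bounds the quadratic form of a symmetric nonnegative
matrix by its eigenvalue. -/
theorem dotProduct_mulVec_le_of_pos_eigenvector (hA : A.IsSymm) (hA0 : ∀ i j, 0 ≤ A i j)
    (hw : ∀ i, 0 < w i) (h : A *ᵥ w = c • w) (x : ι → ℝ) :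
    x ⬝ᵥ (A *ᵥ x) ≤ c * (x ⬝ᵥ x) := by
  have hrow : ∀ i, ∑ j, A i j * w j = c * w i := fun i => by
    have := congrFun h i
    simpa [Matrix.mulVec, dotProduct] using this
  set S : ℝ := ∑ i, ∑ j, A i j * (x i ^ 2 * (w j / w i)) with hS
  have hS1 : S = c * (x ⬝ᵥ x) := by
    rw [hS, dotProduct, Finset.mul_sum]
    refine Finset.sum_congr rfl fun i _ => ?_
    have : ∑ j, A i j * (x i ^ 2 * (w j / w i)) = x i ^ 2 / w i * ∑ j, A i j * w j := by
      rw [Finset.mul_sum]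
      exact Finset.sum_congr rfl fun j _ => by ring
    rw [this, hrow]
    have := (hw i).ne'
    field_simp
  have hS2 : S = ∑ i, ∑ j, A i j * (x j ^ 2 * (w i / w j)) := by
    rw [hS, Finset.sum_comm]
    exact Finset.sum_congr rfl fun i _ => Finset.sum_congr rfl fun j _ => by rw [hA.apply]
  have hle : x ⬝ᵥ (A *ᵥ x) ≤ (S + S) / 2 := by
    nth_rewrite 2 [hS2]
    rw [hS, ← Finset.sum_add_distrib, Finset.sum_div]
    simp only [dotProduct, Matrix.mulVec, Finset.mul_sum]
    refine Finset.sum_le_sum fun i _ => ?_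
    rw [← Finset.sum_add_distrib, Finset.sum_div]
    refine Finset.sum_le_sum fun j _ => ?_
    have hi := hw i
    have hj := hw j
    -- `2 x_i x_j ≤ x_i ^ 2 (w_j / w_i) + x_j ^ 2 (w_i / w_j)`
    have h2 : x i * x j * 2 ≤ x i ^ 2 * (w j / w i) + x j ^ 2 * (w i / w j) := by
      have : x i ^ 2 * (w j / w i) + x j ^ 2 * (w i / w j) - x i * x j * 2
          = (x i * w j - x j * w i) ^ 2 / (w i * w j) := by
        field_simp
        ring
      have h3 : 0 ≤ (x i * w j - x j * w i) ^ 2 / (w i * w j) := by positivity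
      linarith
    nlinarith [hA0 i j, mul_le_mul_of_nonneg_left h2 (hA0 i j)]
  linarith

theorem pow_le_trace_pow [DecidableEq ι] [Nonempty ι] (hA : A.IsSymm)
    (hw : ∀ i, 0 < w i) (h : A *ᵥ w = c • w) (k : ℕ) :
    c ^ (2 * k) ≤ (A ^ (2 * k)).trace := by
  have hsymm : (A ^ k).IsSymm := hA.pow k
  have htr : (A ^ (2 * k)).trace = ∑ i, ∑ j, (A ^ k) i j ^ 2 := by
    rw [two_mul, pow_add, Matrix.trace]
    refine Finset.sum_congr rfl fun i _ => ?_
    rw [Matrix.diag_apply, Matrix.mul_apply]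
    exact Finset.sum_congr rfl fun j _ => by rw [hsymm.apply, sq]
  have hw2 : 0 < ∑ i, w i ^ 2 := Finset.sum_pos (fun i _ => pow_pos (hw i) 2) Finset.univ_nonempty
  refine le_of_mul_le_mul_right ?_ hw2
  rw [htr, Finset.mul_sum, Finset.sum_mul]
  refine Finset.sum_le_sum fun i _ => ?_
  have hrow : ∑ j, (A ^ k) i j * w j = c ^ k * w i := by
    have := congrFun (pow_mulVec_of_mulVec_eq_smul h k) i
    simpa [Matrix.mulVec, dotProduct] using this
  calc c ^ (2 * k) * w i ^ 2 = (∑ j, (A ^ k) i j * w j) ^ 2 := by rw [hrow]; ring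
    _ ≤ _ := Finset.sum_mul_sq_le_sq_mul_sq _ _ _

/-- The Collatz–Wielandt bounds: a nonnegative nonzero test vector `x` with `a x ≤ A x ≤ b x`
entrywise encloses the eigenvalue of a positive eigenvector of `A` between `a` and `b`. -/
theorem eigenvalue_mem_Icc_of_mulVec_bounds (hA : A.IsSymm) (hw : ∀ i, 0 < w i)
    (h : A *ᵥ w = c • w) {x : ι → ℝ} (hx : ∀ i, 0 ≤ x i) (hx0 : ∃ i, 0 < x i) {a b : ℝ}
    (ha : ∀ i, a * x i ≤ (A *ᵥ x) i) (hb : ∀ i, (A *ᵥ x) i ≤ b * x i) :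
    c ∈ Set.Icc a b := by
  have hpos : 0 < w ⬝ᵥ x := by
    obtain ⟨i, hi⟩ := hx0
    exact Finset.sum_pos' (fun j _ => mul_nonneg (hw j).le (hx j))
      ⟨i, Finset.mem_univ _, mul_pos (hw i) hi⟩
  have hswap : w ⬝ᵥ (A *ᵥ x) = c * (w ⬝ᵥ x) := by
    rw [Matrix.dotProduct_mulVec, ← Matrix.mulVec_transpose, hA.eq, h, smul_dotProduct,
      smul_eq_mul]
  constructor
  · refine le_of_mul_le_mul_right ?_ hpos
    rw [← hswap, ← smul_eq_mul, ← dotProduct_smul]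
    exact Finset.sum_le_sum fun i _ => mul_le_mul_of_nonneg_left (ha i) (hw i).le
  · refine le_of_mul_le_mul_right ?_ hpos
    rw [← hswap, ← smul_eq_mul, ← dotProduct_smul]
    exact Finset.sum_le_sum fun i _ => mul_le_mul_of_nonneg_left (hb i) (hw i).le

end Perron

/-! ### Powers of 0-1 matrices count walks -/

section Walks

theorem prod_walk_eq_ite {ι : Type*} {A : Matrix ι ι ℝ} {R : ι → ι → Prop} [DecidableRel R]
    (hA : ∀ u v, A u v = if R u v then 1 else 0) (n : ℕ)
    (f : Fin (n + 1) → ι) [Decidable (∀ i : Fin n, R (f i.castSucc) (f i.succ))] :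
    ∏ i : Fin n, A (f i.castSucc) (f i.succ) =
      if ∀ i : Fin n, R (f i.castSucc) (f i.succ) then 1 else 0 := by
  simp only [hA]
  rw [Finset.prod_ite_zero]
  simp

variable {ι : Type*} [Fintype ι] [DecidableEq ι]

theorem pow_apply_eq_sum_walks (A : Matrix ι ι ℝ) (n : ℕ) (u v : ι) :
    (A ^ n) u v = ∑ f : Fin (n + 1) → ι,
      if f 0 = u ∧ f (Fin.last n) = v then ∏ i : Fin n, A (f i.castSucc) (f i.succ) else 0 := by
  induction n generalizing u with
  | zero =>
    rw [← (Equiv.funUnique (Fin 1) ι).symm.sum_comp]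
    by_cases huv : u = v
    · subst huv
      simp
    · have : ∀ x : ι, ¬(x = u ∧ x = v) := by
        rintro x ⟨rfl, rfl⟩
        exact huv rfl
      simp [huv, this]
  | succ n ih =>
    rw [pow_succ', Matrix.mul_apply]
    simp only [ih, Finset.mul_sum]
    rw [Finset.sum_comm, ← (Fin.consEquiv fun _ : Fin (n + 2) => ι).sum_comp,
      Fintype.sum_prod_type_right]
    refine Finset.sum_congr rfl fun f _ => ?_
    have hl : Fin.last (n + 1) = (Fin.last n).succ := rfl
    simp only [Fin.consEquiv_apply, Fin.cons_zero, hl, Fin.cons_succ, Fin.prod_univ_succ,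
      Fin.castSucc_zero, ← Fin.succ_castSucc]
    rw [Finset.sum_eq_single (f 0), Finset.sum_eq_single u]
    · simp
    · intro x _ hx
      simp [hx]
    · simp
    · intro x _ hx
      simp [hx.symm]
    · simp

variable {A : Matrix ι ι ℝ} {R : ι → ι → Prop}

theorem entrySum_pow_eq_card [DecidableRel R] (hA : ∀ u v, A u v = if R u v then 1 else 0)
    (n : ℕ) :
    entrySum (A ^ n) =
      Nat.card {f : Fin (n + 1) → ι // ∀ i : Fin n, R (f i.castSucc) (f i.succ)} := by
  classical
  have : entrySum (A ^ n) = ∑ f : Fin (n + 1) → ι, ∏ i : Fin n, A (f i.castSucc) (f i.succ) := by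
    simp only [entrySum, pow_apply_eq_sum_walks, ite_and]
    rw [Finset.sum_congr rfl fun i _ => Finset.sum_comm, Finset.sum_comm]
    simp
  rw [this, Nat.card_eq_fintype_card, Fintype.card_subtype]
  simp only [prod_walk_eq_ite hA]
  simp

theorem trace_pow_eq_card [DecidableRel R] (hA : ∀ u v, A u v = if R u v then 1 else 0)
    (n : ℕ) :
    (A ^ n).trace =
      Nat.card {f : Fin (n + 1) → ι //
        f 0 = f (Fin.last n) ∧ ∀ i : Fin n, R (f i.castSucc) (f i.succ)} := by
  classical
  have : (A ^ n).trace = ∑ f : Fin (n + 1) → ι, if f 0 = f (Fin.last n) then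
      ∏ i : Fin n, A (f i.castSucc) (f i.succ) else 0 := by
    simp only [Matrix.trace, Matrix.diag_apply, pow_apply_eq_sum_walks, ite_and]
    rw [Finset.sum_comm]
    simp [eq_comm]
  rw [this, Nat.card_eq_fintype_card, Fintype.card_subtype]
  simp only [prod_walk_eq_ite hA, ← ite_and]
  simp

end Walks

/-! ### Independent sets of the crossed lattice as walks of the transfer matrices -/

/-- Compatibility of neighbouring columns: the relation encoded by `transferT`. -/
abbrev PathCompat (m : ℕ) (u v : PathVec m) : Prop :=
  ∀ i j : Fin (m + 1), ((i : ℕ) = j ∨ (i : ℕ) + 1 = j ∨ (j : ℕ) + 1 = i) →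
    ¬(u.1 i = true ∧ v.1 j = true)

/-- Compatibility of neighbouring cyclic rows: the relation encoded by `transferB`. -/
abbrev CycleCompat (n : ℕ) (u v : CycleVec n) : Prop :=
  ∀ i j : Fin n, ((i : ℕ) = j ∨ ((i : ℕ) + 1) % n = j ∨ ((j : ℕ) + 1) % n = i) →
    ¬(u.1 i = true ∧ v.1 j = true)

theorem transferT_apply (m : ℕ) (u v : PathVec m) :
    transferT m u v = if PathCompat m u v then 1 else 0 := rfl

theorem transferB_apply (n : ℕ) (u v : CycleVec n) :
    transferB n u v = if CycleCompat n u v then 1 else 0 := rfl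

theorem transferT_nonneg (m : ℕ) (u v : PathVec m) : 0 ≤ transferT m u v := by
  rw [transferT_apply]
  split_ifs <;> norm_num

theorem transferB_nonneg (n : ℕ) (u v : CycleVec n) : 0 ≤ transferB n u v := by
  rw [transferB_apply]
  split_ifs <;> norm_num

theorem lam_pos_and_exists_eigenvector (m : ℕ) :
    0 < lam m ∧ ∃ w : PathVec m → ℝ, (∀ i, 0 < w i) ∧ transferT m *ᵥ w = lam m • w :=
  exists_pos_eigenvector (transferT_isSymm m) (transferT_nonneg m) ⟨fun _ => false, by simp⟩
    fun v => by simp [transferT_apply, PathCompat]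

theorem xi_pos_and_exists_eigenvector (n : ℕ) :
    0 < xi n ∧ ∃ w : CycleVec n → ℝ, (∀ i, 0 < w i) ∧ transferB n *ᵥ w = xi n • w :=
  exists_pos_eigenvector (transferB_isSymm n) (transferB_nonneg n) ⟨fun _ => false, by simp⟩
    fun v => by simp [transferB_apply, CycleCompat]

theorem planeCrossed_adj_iff (m n : ℕ) (x y : Fin (m + 1) × Fin (n + 1)) :
    (planeCrossed m n).Adj x y ↔ x ≠ y ∧
      ((x.1 : ℕ) = y.1 ∨ (x.1 : ℕ) + 1 = y.1 ∨ (y.1 : ℕ) + 1 = x.1) ∧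
      ((x.2 : ℕ) = y.2 ∨ (x.2 : ℕ) + 1 = y.2 ∨ (y.2 : ℕ) + 1 = x.2) := by
  obtain ⟨a, b⟩ := x
  obtain ⟨c, d⟩ := y
  simp only [planeCrossed, quadraticLattice, faceDiagonals, SimpleGraph.sup_adj,
    SimpleGraph.boxProd_adj, SimpleGraph.pathGraph_adj, SimpleGraph.fromRel_adj, ne_eq,
    Prod.mk.injEq, Fin.ext_iff]
  omega

theorem numIndepSets_planeCrossed (m n : ℕ) :
    (numIndepSets (planeCrossed m n) : ℝ) = entrySum (transferT m ^ n) := by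
  classical
  rw [entrySum_pow_eq_card (transferT_apply m), numIndepSets, Nat.cast_inj]
  have hsep : ∀ S : Set (Fin (m + 1) × Fin (n + 1)), (planeCrossed m n).IsIndepSet S →
      ∀ x ∈ S, ∀ y ∈ S, ((x.1 : ℕ) = y.1 ∨ (x.1 : ℕ) + 1 = y.1 ∨ (y.1 : ℕ) + 1 = x.1) →
        ((x.2 : ℕ) = y.2 ∨ (x.2 : ℕ) + 1 = y.2 ∨ (y.2 : ℕ) + 1 = x.2) → x = y := by
    intro S hS x hx y hy h1 h2
    by_contra hne
    exact hS hx hy hne ((planeCrossed_adj_iff m n x y).2 ⟨hne, h1, h2⟩)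
  refine Nat.card_congr
    { toFun := fun S => ⟨fun j => ⟨fun i => decide ((i, j) ∈ S.1), fun i i' hi h => ?_⟩,
        fun j i i' hi h => ?_⟩
      invFun := fun f => ⟨{x | (f.1 x.2).1 x.1 = true}, fun x hx y hy hne hadj => ?_⟩
      left_inv := fun S => ?_
      right_inv := fun f => ?_ }
  · simp only [decide_eq_true_eq] at h
    have := hsep S.1 S.2 _ h.1 _ h.2 (by simp only; omega) (by simp)
    simp only [Prod.mk.injEq, Fin.ext_iff] at this
    omega
  · simp only [decide_eq_true_eq] at h
    have := hsep S.1 S.2 _ h.1 _ h.2 (by simp only; omega) (by simp)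
    simp [Prod.mk.injEq, Fin.ext_iff] at this
  · simp only [Set.mem_ofPred_eq] at hx hy
    obtain ⟨i, j⟩ := x
    obtain ⟨i', j'⟩ := y
    rw [planeCrossed_adj_iff] at hadj
    obtain ⟨-, h1, h2⟩ := hadj
    simp only at h1 h2 hx hy
    rcases h2 with h2 | h2 | h2
    · have hj : j = j' := Fin.ext h2
      subst hj
      rcases h1 with h1 | h1 | h1
      · exact hne (by rw [Fin.ext h1])
      · exact (f.1 j).2 i i' h1 ⟨hx, hy⟩
      · exact (f.1 j).2 i' i h1 ⟨hy, hx⟩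
    · have hj : (⟨j, by omega⟩ : Fin n).castSucc = j := rfl
      have hj' : (⟨j, by omega⟩ : Fin n).succ = j' := Fin.ext h2
      exact f.2 ⟨j, by omega⟩ i i' h1 ⟨by rwa [hj], by rwa [hj']⟩
    · have hj : (⟨j', by omega⟩ : Fin n).castSucc = j' := rfl
      have hj' : (⟨j', by omega⟩ : Fin n).succ = j := Fin.ext h2
      exact f.2 ⟨j', by omega⟩ i' i (by omega) ⟨by rwa [hj], by rwa [hj']⟩
  · ext x
    simp
  · ext j i
    simp

/-- A closed walk of length `n` among the columns of height `m + 1`, read row by row, is a walk of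
length `m` among the cyclic rows of circumference `n`. -/
theorem trace_transferT_pow_le (m n : ℕ) (hn : 0 < n) :
    (transferT m ^ n).trace ≤ entrySum (transferB n ^ m) := by
  rw [entrySum_pow_eq_card (transferB_apply n), trace_pow_eq_card (transferT_apply m),
    Nat.cast_le]
  -- the column after column `j` in cyclic order is the end of step `j` of the closed walk
  have hnext : ∀ f : Fin (n + 1) → PathVec m, f 0 = f (Fin.last n) → ∀ j j' : Fin n,
      ((j : ℕ) + 1) % n = j' → f j'.castSucc = f j.succ := by
    intro f h0 j j' h
    rcases Nat.lt_or_ge ((j : ℕ) + 1) n with hlt | hge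
    · rw [Nat.mod_eq_of_lt hlt] at h
      exact congrArg f (Fin.ext h.symm)
    · have hj : (j : ℕ) + 1 = n := by omega
      rw [hj, Nat.mod_self] at h
      have e1 : j'.castSucc = 0 := Fin.ext h.symm
      have e2 : j.succ = Fin.last n := Fin.ext hj
      rw [e1, e2, h0]
  let F : {f : Fin (n + 1) → PathVec m //
        f 0 = f (Fin.last n) ∧ ∀ i : Fin n, PathCompat m (f i.castSucc) (f i.succ)} →
      {g : Fin (m + 1) → CycleVec n // ∀ i : Fin m, CycleCompat n (g i.castSucc) (g i.succ)} :=
    fun f => ⟨fun i => ⟨fun j => (f.1 j.castSucc).1 i, fun j j' hj h => by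
        simp only at h
        rw [hnext f.1 f.2.1 j j' hj] at h
        exact f.2.2 j i i (Or.inl rfl) h⟩, fun i j j' hj h => by
        simp only at h
        rcases hj with hj | hj | hj
        · have : j = j' := Fin.ext hj
          subst this
          exact (f.1 j.castSucc).2 i.castSucc i.succ (by simp) h
        · rw [hnext f.1 f.2.1 j j' hj] at h
          exact f.2.2 j i.castSucc i.succ (by simp) h
        · rw [hnext f.1 f.2.1 j' j hj] at h
          exact f.2.2 j' i.succ i.castSucc (by simp) h.symm⟩
  refine Nat.card_le_card_of_injective F fun f g hfg => ?_
  have hcol : ∀ j : Fin n, f.1 j.castSucc = g.1 j.castSucc := fun j => by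
    ext i
    have := congrArg (fun x => (x.1 i).1 j) hfg
    simpa [F] using this
  apply Subtype.ext
  funext j
  refine Fin.lastCases ?_ hcol j
  have h0 := hcol ⟨0, hn⟩
  have e : (⟨0, hn⟩ : Fin n).castSucc = 0 := rfl
  rw [e] at h0
  rw [← f.2.1, ← g.2.1, h0]

/-! ### Comparing numbers of independent sets -/

section Comparison

variable {V W : Type*}

theorem numIndepSets_pos [Finite V] (G : SimpleGraph V) : 0 < numIndepSets G := by
  have : Nonempty {S : Set V // G.IsIndepSet S} := ⟨⟨∅, Set.pairwise_empty _⟩⟩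
  exact Nat.card_pos

/-- An independent set is determined by its preimages under a jointly surjective family of
homomorphisms, and these preimages are independent. -/
theorem numIndepSets_le_pow_card [Finite W] {K : Type*} [Finite K] {G : SimpleGraph V}
    {G' : SimpleGraph W} (φ : K → W → V)
    (hφ : ∀ k x y, G'.Adj x y → G.Adj (φ k x) (φ k y)) (hcov : ∀ v, ∃ k x, φ k x = v) :
    numIndepSets G ≤ numIndepSets G' ^ Nat.card K := by
  rw [numIndepSets, numIndepSets, ← Nat.card_fun]
  refine Nat.card_le_card_of_injective
    (fun S k => ⟨φ k ⁻¹' S.1, fun x hx y hy _ hadj => ?_⟩) fun S T hST => ?_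
  · have := hφ k x y hadj
    exact S.2 hx hy this.ne this
  · ext v
    obtain ⟨k, x, rfl⟩ := hcov v
    have h1 := congrArg Subtype.val (congrFun hST k)
    exact Set.ext_iff.1 h1 x

theorem numIndepSets_le_of_surjective [Finite W] {G : SimpleGraph V} {G' : SimpleGraph W}
    {φ : W → V} (hs : Function.Surjective φ)
    (hφ : ∀ x y, G'.Adj x y → G.Adj (φ x) (φ y)) : numIndepSets G ≤ numIndepSets G' := by
  simpa using numIndepSets_le_pow_card (K := Unit) (fun _ => φ) (fun _ => hφ)
    fun v => ⟨(), hs v⟩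

theorem numIndepSets_le_of_injective [Finite V] {G : SimpleGraph V} {G' : SimpleGraph W}
    {φ : W → V} (hi : Function.Injective φ)
    (hφ : ∀ x y, G.Adj (φ x) (φ y) → G'.Adj x y) : numIndepSets G' ≤ numIndepSets G := by
  refine Nat.card_le_card_of_injective
    (fun S => ⟨φ '' S.1, ?_⟩) fun S T hST => ?_
  · rintro _ ⟨x, hx, rfl⟩ _ ⟨y, hy, rfl⟩ hne hadj
    exact S.2 hx hy (fun h => hne (h ▸ rfl)) (hφ x y hadj)
  · exact Subtype.ext (hi.image_injective (congrArg Subtype.val hST))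

theorem numIndepSets_map_le [Finite V] {G : SimpleGraph V} {f : V → W}
    (hs : Function.Surjective f) (hne : ∀ x y, G.Adj x y → f x ≠ f y) :
    numIndepSets (G.map f) ≤ numIndepSets G :=
  numIndepSets_le_of_surjective hs fun _ _ h => SimpleGraph.map_adj_apply' h (hne _ _ h)

end Comparison

theorem numIndepSets_planeCrossed_comm (m n : ℕ) :
    numIndepSets (planeCrossed m n) = numIndepSets (planeCrossed n m) := by
  have key : ∀ m n, numIndepSets (planeCrossed m n) ≤ numIndepSets (planeCrossed n m) := by
    intro m n
    refine numIndepSets_le_of_surjective Prod.swap_surjective fun x y h => ?_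
    rw [planeCrossed_adj_iff] at h ⊢
    exact ⟨fun h' => h.1 (Prod.swap_injective h'), h.2.2, h.2.1⟩
  exact le_antisymm (key m n) (key n m)

/-- A grid is covered by translates of a smaller block; the last translate in each direction is
pushed back so as to stay inside the grid. -/
theorem numIndepSets_planeCrossed_le_pow {a b m n : ℕ} (ha : a ≤ m) (hb : b ≤ n) :
    numIndepSets (planeCrossed m n) ≤
      numIndepSets (planeCrossed a b) ^ ((m / (a + 1) + 1) * (n / (b + 1) + 1)) := by
  have hlt : ∀ {a m : ℕ}, a ≤ m → ∀ (s : ℕ) (x : Fin (a + 1)),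
      min (s * (a + 1)) (m - a) + x < m + 1 := by
    intro a m ha s x
    have := min_le_right (s * (a + 1)) (m - a)
    omega
  have hcov : ∀ {a m : ℕ}, a ≤ m → ∀ r : Fin (m + 1),
      ∃ (s : Fin (m / (a + 1) + 1)) (x : Fin (a + 1)), min (s * (a + 1)) (m - a) + x = (r : ℕ) := by
    intro a m ha r
    have hdm := Nat.div_add_mod' (r : ℕ) (a + 1)
    have hmod := Nat.mod_lt (r : ℕ) (Nat.succ_pos a)
    have hs : (r : ℕ) / (a + 1) < m / (a + 1) + 1 :=
      Nat.lt_succ_of_le (Nat.div_le_div_right (Nat.lt_succ_iff.1 r.2))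
    rcases le_total ((r : ℕ) / (a + 1) * (a + 1)) (m - a) with h | h
    · exact ⟨⟨_, hs⟩, ⟨(r : ℕ) % (a + 1), hmod⟩, by simp only [min_eq_left h]; omega⟩
    · refine ⟨⟨_, hs⟩, ⟨(r : ℕ) - (m - a), by omega⟩, ?_⟩
      simp only [min_eq_right h]
      omega
  have := numIndepSets_le_pow_card (G := planeCrossed m n) (G' := planeCrossed a b)
    (K := Fin (m / (a + 1) + 1) × Fin (n / (b + 1) + 1))
    (fun k x => (⟨_, hlt ha k.1 x.1⟩, ⟨_, hlt hb k.2 x.2⟩)) ?_ ?_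
  · simpa using this
  · intro k x y h
    rw [planeCrossed_adj_iff] at h ⊢
    simp only [ne_eq, Prod.ext_iff, Fin.ext_iff] at h ⊢
    omega
  · rintro ⟨r, c⟩
    obtain ⟨s, x, hx⟩ := hcov ha r
    obtain ⟨t, y, hy⟩ := hcov hb c
    exact ⟨(s, t), (x, y), Prod.ext (Fin.ext hx) (Fin.ext hy)⟩

/-! ### The cylinder and the torus between two planes -/

theorem eq_of_natCast_zmod_eq {n a b : ℕ} (hn : 2 ≤ n)
    (h : (a : ZMod n) = b) (hab : a = b ∨ a + 1 = b ∨ b + 1 = a) : a = b := by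
  rw [ZMod.natCast_eq_natCast_iff] at h
  rcases hab with hab | hab | hab
  · exact hab
  · have h1 := (Nat.modEq_iff_dvd' (by omega)).1 h
    have h2 : b - a = 1 := by omega
    rw [h2, Nat.dvd_one] at h1
    omega
  · have h1 := (Nat.modEq_iff_dvd' (by omega)).1 h.symm
    have h2 : a - b = 1 := by omega
    rw [h2, Nat.dvd_one] at h1
    omega

theorem exists_fin_natCast_eq {n : ℕ} [NeZero n] (z : ZMod n) :
    ∃ x : Fin (n + 1), ((x : ℕ) : ZMod n) = z :=
  ⟨⟨z.val, (ZMod.val_lt z).trans (Nat.lt_succ_self n)⟩, by simp⟩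

theorem numIndepSets_cylinderCrossed_le {m n : ℕ} (hn : 2 ≤ n) :
    numIndepSets (cylinderCrossed m n) ≤ numIndepSets (planeCrossed m n) := by
  have : NeZero n := ⟨by omega⟩
  refine numIndepSets_map_le (fun z => ?_) fun x y h he => ?_
  · obtain ⟨x, hx⟩ := exists_fin_natCast_eq z.2
    exact ⟨(z.1, x), by simp [hx]⟩
  · rw [planeCrossed_adj_iff] at h
    simp only [Prod.mk.injEq] at he
    exact h.1 (Prod.ext he.1 (Fin.ext (eq_of_natCast_zmod_eq hn he.2 h.2.2)))

theorem numIndepSets_torusCrossed_le {m n : ℕ} (hm : 2 ≤ m) (hn : 2 ≤ n) :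
    numIndepSets (torusCrossed m n) ≤ numIndepSets (cylinderCrossed m n) := by
  have : NeZero n := ⟨by omega⟩
  have : NeZero m := ⟨by omega⟩
  refine numIndepSets_map_le (fun z => ?_) fun x y h he => ?_
  · obtain ⟨x, hx⟩ := exists_fin_natCast_eq z.1
    exact ⟨(x, z.2), by simp [hx]⟩
  · obtain ⟨hne, u, v, huv, rfl, rfl⟩ := h
    rw [planeCrossed_adj_iff] at huv
    simp only [Prod.mk.injEq] at he
    exact hne (Prod.ext (Fin.ext (eq_of_natCast_zmod_eq hm he.1 huv.2.1)) he.2)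

/-- Leaving the last two rows and columns empty embeds the independent sets of a smaller plane
lattice into those of the torus. -/
theorem numIndepSets_planeCrossed_le_torusCrossed (m n : ℕ) :
    numIndepSets (planeCrossed m n) ≤ numIndepSets (torusCrossed (m + 2) (n + 2)) := by
  have hcast : ∀ {m : ℕ} (u : Fin (m + 2 + 1)) (x : Fin (m + 1)),
      ((u : ℕ) : ZMod (m + 2)) = ((x : ℕ) : ZMod (m + 2)) →
        (u : ℕ) = x ∨ ((u : ℕ) = m + 2 ∧ (x : ℕ) = 0) := by
    intro m u x h
    rw [ZMod.natCast_eq_natCast_iff', Nat.mod_eq_of_lt (a := (x : ℕ)) (by omega)] at h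
    rcases Nat.lt_or_ge (u : ℕ) (m + 2) with hu | hu
    · rw [Nat.mod_eq_of_lt hu] at h
      exact Or.inl h
    · have hu' : (u : ℕ) = m + 2 := by omega
      rw [hu', Nat.mod_self] at h
      exact Or.inr ⟨hu', h.symm⟩
  have hinj : ∀ {m : ℕ} (x y : Fin (m + 1)),
      ((x : ℕ) : ZMod (m + 2)) = ((y : ℕ) : ZMod (m + 2)) → x = y := by
    intro m x y h
    rw [ZMod.natCast_eq_natCast_iff', Nat.mod_eq_of_lt (by omega), Nat.mod_eq_of_lt (by omega)] at h
    exact Fin.ext h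
  refine numIndepSets_le_of_injective
    (φ := fun x => (((x.1 : ℕ) : ZMod (m + 2)), ((x.2 : ℕ) : ZMod (n + 2))))
    (fun x y h => ?_) fun x y h => ?_
  · simp only [Prod.mk.injEq] at h
    exact Prod.ext (hinj _ _ h.1) (hinj _ _ h.2)
  · rw [torusCrossed, cylinderCrossed, SimpleGraph.map_map] at h
    obtain ⟨hne, u, v, huv, hu, hv⟩ := h
    simp only [Function.comp_apply, Prod.mk.injEq] at hu hv
    rw [planeCrossed_adj_iff] at huv ⊢
    have h1 := hcast _ _ hu.1
    have h2 := hcast _ _ hu.2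
    have h3 := hcast _ _ hv.1
    have h4 := hcast _ _ hv.2
    refine ⟨fun h => hne (by rw [h]), ?_, ?_⟩ <;> omega

/-! ### Existence of the entropy -/

/-- The logarithm of the number of independent sets of the plane crossed lattice. -/
noncomputable def logCount (m n : ℕ) : ℝ := Real.log (numIndepSets (planeCrossed m n))

/-- The logarithm of the entropy constant, as the infimum of `logCount` per vertex. -/
noncomputable def logEntropy : ℝ :=
  ⨅ k : ℕ × ℕ, logCount k.1 k.2 / (((k.1 : ℝ) + 1) * ((k.2 : ℝ) + 1))

theorem logCount_nonneg (m n : ℕ) : 0 ≤ logCount m n :=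
  Real.log_natCast_nonneg _

theorem logCount_div_le {a b m n : ℕ} (ha : a ≤ m) (hb : b ≤ n) :
    logCount m n / (((m : ℝ) + 1) * ((n : ℝ) + 1)) ≤
      (1 / ((a : ℝ) + 1) + 1 / ((m : ℝ) + 1)) * (1 / ((b : ℝ) + 1) + 1 / ((n : ℝ) + 1)) *
        logCount a b := by
  have h1 : logCount m n ≤ ((m / (a + 1) + 1) * (n / (b + 1) + 1) : ℕ) * logCount a b := by
    rw [logCount, logCount, ← Real.log_pow]
    refine Real.log_le_log (by exact_mod_cast numIndepSets_pos _) ?_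
    exact_mod_cast numIndepSets_planeCrossed_le_pow ha hb
  have hdiv : ∀ a m : ℕ, (((m / (a + 1) : ℕ) : ℝ) + 1) ≤
      (1 / ((a : ℝ) + 1) + 1 / ((m : ℝ) + 1)) * ((m : ℝ) + 1) := by
    intro a m
    have h : ((m / (a + 1) : ℕ) : ℝ) ≤ (m : ℝ) / ((a + 1 : ℕ) : ℝ) := Nat.cast_div_le
    have e : (1 / ((a : ℝ) + 1) + 1 / ((m : ℝ) + 1)) * ((m : ℝ) + 1)
        = (m : ℝ) / (a + 1) + 1 / ((a : ℝ) + 1) + 1 := by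
      field_simp
    have : 0 ≤ 1 / ((a : ℝ) + 1) := by positivity
    push_cast at h
    rw [e]
    linarith
  rw [div_le_iff₀ (by positivity)]
  refine h1.trans ?_
  have h2 := mul_le_mul (hdiv a m) (hdiv b n) (by positivity) (by positivity)
  have h3 := mul_le_mul_of_nonneg_right h2 (logCount_nonneg a b)
  push_cast
  linarith

/-- Fekete's lemma in two dimensions, for the logarithmic number of independent sets. -/
theorem tendsto_logCount_div :
    Tendsto (fun k : ℕ × ℕ => logCount k.1 k.2 / (((k.1 : ℝ) + 1) * ((k.2 : ℝ) + 1)))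
      (atTop ×ˢ atTop) (𝓝 logEntropy) := by
  have hbdd : BddBelow (Set.range fun k : ℕ × ℕ =>
      logCount k.1 k.2 / (((k.1 : ℝ) + 1) * ((k.2 : ℝ) + 1))) := by
    refine ⟨0, ?_⟩
    rintro _ ⟨k, rfl⟩
    exact div_nonneg (logCount_nonneg _ _) (by positivity)
  rw [tendsto_order]
  refine ⟨fun c hc => Eventually.of_forall fun k => hc.trans_le (ciInf_le hbdd k), fun c hc => ?_⟩
  obtain ⟨⟨a, b⟩, hab⟩ := exists_lt_of_ciInf_lt hc
  have hlim : Tendsto (fun k : ℕ × ℕ => (1 / ((a : ℝ) + 1) + 1 / ((k.1 : ℝ) + 1)) *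
      (1 / ((b : ℝ) + 1) + 1 / ((k.2 : ℝ) + 1)) * logCount a b) (atTop ×ˢ atTop)
      (𝓝 ((1 / ((a : ℝ) + 1) + 0) * (1 / ((b : ℝ) + 1) + 0) * logCount a b)) := by
    have h0 := tendsto_one_div_add_atTop_nhds_zero_nat (𝕜 := ℝ)
    exact ((tendsto_const_nhds.add (h0.comp tendsto_fst)).mul
      (tendsto_const_nhds.add (h0.comp tendsto_snd))).mul_const _
  have hlt : (1 / ((a : ℝ) + 1) + 0) * (1 / ((b : ℝ) + 1) + 0) * logCount a b < c := by
    refine lt_of_eq_of_lt ?_ hab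
    field_simp
    ring
  filter_upwards [hlim.eventually_lt_const hlt,
    (eventually_ge_atTop a).prod_mk (eventually_ge_atTop b)] with k hk hk'
  exact (logCount_div_le hk'.1 hk'.2).trans_lt hk

theorem tendsto_natCast_add_div_add (a b : ℝ) :
    Tendsto (fun n : ℕ => ((n : ℝ) + a) / ((n : ℝ) + b)) atTop (𝓝 1) := by
  have hb : Tendsto (fun n : ℕ => (n : ℝ) + b) atTop atTop :=
    tendsto_atTop_add_const_right _ _ tendsto_natCast_atTop_atTop
  have h : Tendsto (fun n : ℕ => 1 + (a - b) / ((n : ℝ) + b)) atTop (𝓝 (1 + 0)) :=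
    tendsto_const_nhds.add (tendsto_const_nhds.div_atTop hb)
  rw [add_zero] at h
  refine h.congr' ?_
  filter_upwards [hb.eventually_gt_atTop 0] with n hn
  field_simp
  ring

/-- Any count squeezed between those of the plane lattices of sizes `(m, n)` and
`(m + 2, n + 2)` has the same entropy, for every normalization equivalent to `m * n`. -/
theorem tendsto_rpow_of_squeeze {F : ℕ × ℕ → ℕ} (a b : ℝ)
    (hl : ∀ m n, numIndepSets (planeCrossed m n) ≤ F (m + 2, n + 2))
    (hu : ∀ m n, F (m + 2, n + 2) ≤ numIndepSets (planeCrossed (m + 2) (n + 2))) :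
    Tendsto (fun k : ℕ × ℕ => (F k : ℝ) ^ (1 / (((k.1 : ℝ) + a) * ((k.2 : ℝ) + b))))
      (atTop ×ˢ atTop) (𝓝 (Real.exp logEntropy)) := by
  have hratio : ∀ c : ℝ, Tendsto (fun k : ℕ × ℕ => ((k.1 : ℝ) + c) / ((k.1 : ℝ) + a) *
      (((k.2 : ℝ) + c) / ((k.2 : ℝ) + b))) (atTop ×ˢ atTop) (𝓝 1) := fun c => by
    simpa using ((tendsto_natCast_add_div_add c a).comp tendsto_fst).mul
      ((tendsto_natCast_add_div_add c b).comp tendsto_snd)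
  have hsub : Tendsto (fun k : ℕ × ℕ => (k.1 - 2, k.2 - 2)) (atTop ×ˢ atTop)
      (atTop ×ˢ atTop : Filter (ℕ × ℕ)) :=
    ((tendsto_sub_atTop_nat 2).comp tendsto_fst).prodMk
      ((tendsto_sub_atTop_nat 2).comp tendsto_snd)
  have hlow := (tendsto_logCount_div.comp hsub).mul (hratio (-1))
  have hupp := tendsto_logCount_div.mul (hratio 1)
  rw [mul_one] at hlow hupp
  have hpos : ∀ c : ℝ, ∀ᶠ n : ℕ in atTop, 0 < (n : ℝ) + c := fun c =>
    (tendsto_atTop_add_const_right _ _ tendsto_natCast_atTop_atTop).eventually_gt_atTop 0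
  have hev : ∀ᶠ k : ℕ × ℕ in atTop ×ˢ atTop, (2 ≤ k.1 ∧ 0 < (k.1 : ℝ) + a) ∧
      (2 ≤ k.2 ∧ 0 < (k.2 : ℝ) + b) :=
    ((eventually_ge_atTop 2).and (hpos a)).prod_mk ((eventually_ge_atTop 2).and (hpos b))
  have hlog : Tendsto (fun k : ℕ × ℕ => Real.log (F k) / (((k.1 : ℝ) + a) * ((k.2 : ℝ) + b)))
      (atTop ×ˢ atTop) (𝓝 logEntropy) := by
    refine tendsto_of_tendsto_of_tendsto_of_le_of_le' hlow hupp ?_ ?_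
    · filter_upwards [hev] with k hk
      obtain ⟨⟨h1, h1'⟩, h2, h2'⟩ := hk
      obtain ⟨i, hi⟩ := Nat.exists_eq_add_of_le' h1
      obtain ⟨j, hj⟩ := Nat.exists_eq_add_of_le' h2
      obtain ⟨k1, k2⟩ := k
      simp only at hi hj h1' h2'
      subst hi hj
      have e : ∀ i : ℕ, ((i + 2 : ℕ) : ℝ) + -1 = (i : ℝ) + 1 := fun i => by push_cast; ring
      simp only [Function.comp_apply, Nat.add_sub_cancel, e]
      have hle : logCount i j ≤ Real.log (F (i + 2, j + 2)) :=
        Real.log_le_log (by exact_mod_cast numIndepSets_pos _) (by exact_mod_cast hl i j)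
      refine le_of_eq_of_le ?_ (div_le_div_of_nonneg_right hle (mul_pos h1' h2').le)
      field_simp
    · filter_upwards [hev] with k hk
      obtain ⟨⟨h1, h1'⟩, h2, h2'⟩ := hk
      obtain ⟨i, hi⟩ := Nat.exists_eq_add_of_le' h1
      obtain ⟨j, hj⟩ := Nat.exists_eq_add_of_le' h2
      obtain ⟨k1, k2⟩ := k
      simp only at hi hj h1' h2'
      subst hi hj
      have hF : 0 < F (i + 2, j + 2) := (numIndepSets_pos _).trans_le (hl i j)
      have hle : Real.log (F (i + 2, j + 2)) ≤ logCount (i + 2) (j + 2) :=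
        Real.log_le_log (by exact_mod_cast hF) (by exact_mod_cast hu i j)
      refine (div_le_div_of_nonneg_right hle (mul_pos h1' h2').le).trans_eq ?_
      field_simp
  refine (Real.continuous_exp.continuousAt.tendsto.comp hlog).congr' ?_
  filter_upwards [hev] with k hk
  obtain ⟨⟨h1, -⟩, h2, -⟩ := hk
  obtain ⟨i, hi⟩ := Nat.exists_eq_add_of_le' h1
  obtain ⟨j, hj⟩ := Nat.exists_eq_add_of_le' h2
  obtain ⟨k1, k2⟩ := k
  simp only at hi hj
  subst hi hj
  have hF : 0 < F (i + 2, j + 2) := (numIndepSets_pos _).trans_le (hl i j)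
  rw [Function.comp_apply, Real.rpow_def_of_pos (by exact_mod_cast hF), div_eq_mul_one_div]

theorem numIndepSets_planeCrossed_le_add_two (m n : ℕ) :
    numIndepSets (planeCrossed m n) ≤ numIndepSets (cylinderCrossed (m + 2) (n + 2)) :=
  (numIndepSets_planeCrossed_le_torusCrossed m n).trans
    (numIndepSets_torusCrossed_le (by omega) (by omega))

theorem tendsto_planeCrossed_rpow (a b : ℝ) :
    Tendsto (fun k : ℕ × ℕ => (numIndepSets (planeCrossed k.1 k.2) : ℝ) ^
      (1 / (((k.1 : ℝ) + a) * ((k.2 : ℝ) + b)))) (atTop ×ˢ atTop) (𝓝 (Real.exp logEntropy)) :=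
  tendsto_rpow_of_squeeze a b
    (fun m n => (numIndepSets_planeCrossed_le_add_two m n).trans
      (numIndepSets_cylinderCrossed_le (by omega))) fun _ _ => le_rfl

theorem tendsto_indepRoot_planeCrossed :
    Tendsto (fun k : ℕ × ℕ => indepRoot (planeCrossed k.1 k.2)) (atTop ×ˢ atTop)
      (𝓝 (Real.exp logEntropy)) := by
  refine (tendsto_planeCrossed_rpow 1 1).congr fun k => ?_
  simp [indepRoot]

theorem tendsto_indepRoot_cylinderCrossed :
    Tendsto (fun k : ℕ × ℕ => indepRoot (cylinderCrossed k.1 k.2)) (atTop ×ˢ atTop)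
      (𝓝 (Real.exp logEntropy)) := by
  refine (tendsto_rpow_of_squeeze (F := fun k => numIndepSets (cylinderCrossed k.1 k.2)) 1 0
    numIndepSets_planeCrossed_le_add_two
    fun m n => numIndepSets_cylinderCrossed_le (by omega)).congr fun k => ?_
  simp [indepRoot]

theorem tendsto_indepRoot_torusCrossed :
    Tendsto (fun k : ℕ × ℕ => indepRoot (torusCrossed k.1 k.2)) (atTop ×ˢ atTop)
      (𝓝 (Real.exp logEntropy)) := by
  refine (tendsto_rpow_of_squeeze (F := fun k => numIndepSets (torusCrossed k.1 k.2)) 0 0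
    numIndepSets_planeCrossed_le_torusCrossed
    fun m n => (numIndepSets_torusCrossed_le (by omega) (by omega)).trans
      (numIndepSets_cylinderCrossed_le (by omega))).congr fun k => ?_
  simp [indepRoot]

/-! ### Eigenvalue bounds for the entropy -/

theorem exists_logCount_bounds (m : ℕ) :
    ∃ a b : ℝ, ∀ n : ℕ, a + n * Real.log (lam m) ≤ logCount m n ∧
      logCount m n ≤ b + n * Real.log (lam m) := by
  obtain ⟨hpos, w, hw, h⟩ := lam_pos_and_exists_eigenvector m
  obtain ⟨a, b, ha, hb, hab⟩ := exists_entrySum_pow_bounds (transferT_nonneg m) hw h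
  refine ⟨Real.log a, Real.log b, fun n => ?_⟩
  have hn := hab n
  rw [← numIndepSets_planeCrossed] at hn
  have hZ : (0 : ℝ) < numIndepSets (planeCrossed m n) := by exact_mod_cast numIndepSets_pos _
  have hc : 0 < lam m ^ n := pow_pos hpos n
  rw [← Real.log_pow, ← Real.log_mul ha.ne' hc.ne', ← Real.log_mul hb.ne' hc.ne', logCount]
  exact ⟨Real.log_le_log (mul_pos ha hc) hn.1, Real.log_le_log hZ hn.2⟩

theorem tendsto_of_linear_bounds {s : ℕ → ℝ} {a b c : ℝ}
    (h : ∀ n : ℕ, a + n * c ≤ s n ∧ s n ≤ b + n * c) :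
    Tendsto (fun n : ℕ => s n / n) atTop (𝓝 c) := by
  have hlim : ∀ a : ℝ, Tendsto (fun n : ℕ => a / (n : ℝ) + c) atTop (𝓝 c) := fun a => by
    simpa using (tendsto_const_div_atTop_nhds_zero_nat a).add_const c
  refine tendsto_of_tendsto_of_tendsto_of_le_of_le' (hlim a) (hlim b) ?_ ?_ <;>
  · filter_upwards [eventually_gt_atTop 0] with n hn
    have hn' : (0 : ℝ) < n := by exact_mod_cast hn
    rw [div_add' _ _ _ hn'.ne', div_le_div_iff_of_pos_right hn', mul_comm c]
    first | exact (h n).1 | exact (h n).2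

theorem tendsto_logCount_right (m : ℕ) :
    Tendsto (fun n : ℕ => logCount m n / n) atTop (𝓝 (Real.log (lam m))) := by
  obtain ⟨a, b, h⟩ := exists_logCount_bounds m
  exact tendsto_of_linear_bounds h

theorem tendsto_log_lam_div :
    Tendsto (fun m : ℕ => Real.log (lam m) / m) atTop (𝓝 logEntropy) := by
  have hlim : Tendsto (fun k : ℕ × ℕ => logCount k.1 k.2 / ((k.1 : ℝ) * k.2))
      (atTop ×ˢ atTop) (𝓝 logEntropy) := by
    have h1 := tendsto_logCount_div.mul
      (((tendsto_natCast_add_div_add 1 0).comp tendsto_fst).mul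
        ((tendsto_natCast_add_div_add 1 0).comp (tendsto_snd (f := (atTop : Filter ℕ)))))
    rw [mul_one, mul_one] at h1
    refine h1.congr' ?_
    filter_upwards [(eventually_gt_atTop 0).prod_mk (eventually_gt_atTop 0)] with k hk
    obtain ⟨hk1, hk2⟩ := hk
    have hk1' : (k.1 : ℝ) ≠ 0 := by exact_mod_cast hk1.ne'
    have hk2' : (k.2 : ℝ) ≠ 0 := by exact_mod_cast hk2.ne'
    simp only [Function.comp_apply, add_zero]
    field_simp
  rw [Metric.tendsto_nhds]
  intro ε hε
  have hev := (Metric.tendsto_nhds.1 hlim (ε / 2) (by positivity)).curry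
  filter_upwards [hev, eventually_gt_atTop 0] with m hm hm0
  have hrow : Tendsto (fun n : ℕ => logCount m n / ((m : ℝ) * n)) atTop
      (𝓝 (Real.log (lam m) / m)) := by
    refine ((tendsto_logCount_right m).div_const (m : ℝ)).congr fun n => ?_
    rw [div_div, mul_comm]
  have hle := le_of_tendsto (hrow.dist tendsto_const_nhds) (hm.mono fun n hn => hn.le)
  exact hle.trans_lt (by linarith)

/-- The Rayleigh quotient of `T ^ p` at the vector `T ^ q 1` is a ratio of counts of the lattices of
widths `p + 2 * q` and `2 * q`. -/
theorem logCount_sub_le (p q m : ℕ) :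
    logCount (p + 2 * q) m - logCount (2 * q) m ≤ p * Real.log (lam m) := by
  obtain ⟨hpos, w, hw, h⟩ := lam_pos_and_exists_eigenvector m
  set T := transferT m with hT
  have hsym : (T ^ q).IsSymm := (transferT_isSymm m).pow q
  have hentry : ∀ r, entrySum (T ^ (r + 2 * q)) =
      (T ^ q *ᵥ 1) ⬝ᵥ (T ^ r *ᵥ (T ^ q *ᵥ 1)) := by
    intro r
    have e : T ^ (r + 2 * q) = T ^ q * (T ^ r * T ^ q) := by
      rw [← pow_add, ← pow_add]
      congr 1
      omega
    rw [Matrix.mulVec_mulVec, dotProduct_comm, Matrix.dotProduct_mulVec,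
      ← Matrix.mulVec_transpose, hsym.eq, Matrix.mulVec_mulVec, ← e]
    simp [entrySum, dotProduct, Matrix.mulVec]
  have hschur := dotProduct_mulVec_le_of_pos_eigenvector ((transferT_isSymm m).pow p)
    (pow_entry_nonneg (transferT_nonneg m) p) hw (pow_mulVec_of_mulVec_eq_smul h p) (T ^ q *ᵥ 1)
  have h0 := hentry 0
  rw [pow_zero, Matrix.one_mulVec, zero_add] at h0
  rw [← hT, ← hentry p, ← h0, hT, ← numIndepSets_planeCrossed, ← numIndepSets_planeCrossed,
    numIndepSets_planeCrossed_comm m, numIndepSets_planeCrossed_comm m] at hschur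
  have hZ : ∀ a b, (0 : ℝ) < numIndepSets (planeCrossed a b) := fun a b => by
    exact_mod_cast numIndepSets_pos _
  have := Real.log_le_log (hZ _ _) hschur
  rw [Real.log_mul (pow_pos hpos p).ne' (hZ _ _).ne', Real.log_pow] at this
  rw [logCount, logCount]
  linarith

theorem lam_div_rpow_le_exp_logEntropy {p : ℕ} (q : ℕ) (hp : 1 ≤ p) :
    (lam (p + 2 * q) / lam (2 * q)) ^ (1 / (p : ℝ)) ≤ Real.exp logEntropy := by
  have h1 := (lam_pos_and_exists_eigenvector (p + 2 * q)).1
  have h2 := (lam_pos_and_exists_eigenvector (2 * q)).1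
  have hlim := (tendsto_logCount_right (p + 2 * q)).sub (tendsto_logCount_right (2 * q))
  have hle := le_of_tendsto_of_tendsto' hlim (tendsto_log_lam_div.const_mul (p : ℝ)) fun m => by
    rw [← sub_div, ← mul_div_assoc]
    exact div_le_div_of_nonneg_right (logCount_sub_le p q m) (Nat.cast_nonneg m)
  have hp' : (0 : ℝ) < p := by exact_mod_cast hp
  rw [Real.rpow_def_of_pos (div_pos h1 h2), Real.exp_le_exp, Real.log_div h1.ne' h2.ne',
    mul_one_div, div_le_iff₀ hp']
  linarith

theorem exp_logEntropy_le_xi_rpow {k : ℕ} (hk : 1 ≤ k) :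
    Real.exp logEntropy ≤ xi (2 * k) ^ (1 / (2 * (k : ℝ))) := by
  obtain ⟨hxi, w, hw, h⟩ := xi_pos_and_exists_eigenvector (2 * k)
  obtain ⟨a, b, ha, hb, hab⟩ := exists_entrySum_pow_bounds (transferB_nonneg (2 * k)) hw h
  have hbound : ∀ m : ℕ, 2 * k * Real.log (lam m) ≤ Real.log b + m * Real.log (xi (2 * k)) := by
    intro m
    obtain ⟨hpos, v, hv, hv'⟩ := lam_pos_and_exists_eigenvector m
    have h1 := ((pow_le_trace_pow (transferT_isSymm m) hv hv' k).trans
      (trace_transferT_pow_le m (2 * k) (by omega))).trans (hab m).2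
    have h2 := Real.log_le_log (pow_pos hpos _) h1
    rw [Real.log_pow, Real.log_mul hb.ne' (pow_pos hxi m).ne', Real.log_pow] at h2
    exact_mod_cast h2
  have hrhs : Tendsto (fun m : ℕ => (Real.log b + m * Real.log (xi (2 * k))) / m) atTop
      (𝓝 (Real.log (xi (2 * k)))) :=
    tendsto_of_linear_bounds fun _ => ⟨le_rfl, le_rfl⟩
  have hle := le_of_tendsto_of_tendsto' (tendsto_log_lam_div.const_mul (2 * (k : ℝ))) hrhs
    fun m => by
      rw [← mul_div_assoc]
      exact div_le_div_of_nonneg_right (hbound m) (Nat.cast_nonneg m)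
  have hk' : (0 : ℝ) < 2 * k := by
    have : (0 : ℝ) < k := by exact_mod_cast hk
    linarith
  rw [Real.rpow_def_of_pos hxi, Real.exp_le_exp, mul_one_div, le_div_iff₀ hk']
  linarith

/-! ### Fibonacci words -/

/-- The `0`-`1` words of length `n` without two consecutive `1`s that are empty or end in `0`.
Such a word of length at least two is `0w` or `10w` with a shorter word `w` of the same kind. -/
def FibWord : ℕ → Type
  | 0 => Unit
  | 1 => Unit
  | n + 2 => FibWord (n + 1) ⊕ FibWord n

namespace FibWord

instance instFintype : (n : ℕ) → Fintype (FibWord n)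
  | 0 => inferInstanceAs (Fintype Unit)
  | 1 => inferInstanceAs (Fintype Unit)
  | n + 2 =>
    letI := instFintype (n + 1)
    letI := instFintype n
    inferInstanceAs (Fintype (FibWord (n + 1) ⊕ FibWord n))

theorem sum_zero (f : FibWord 0 → ℕ) : ∑ w, f w = f () := Fintype.sum_unique (ι := Unit) f

theorem sum_one (f : FibWord 1 → ℕ) : ∑ w, f w = f () := Fintype.sum_unique (ι := Unit) f

theorem sum_add_two {n : ℕ} (f : FibWord (n + 2) → ℕ) :
    ∑ w, f w = ∑ w : FibWord (n + 1), f (Sum.inl w) + ∑ w : FibWord n, f (Sum.inr w) :=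
  Fintype.sum_sum_type (α₁ := FibWord (n + 1)) (α₂ := FibWord n) f

end FibWord

/-- Prefix an infinite `0`-`1` word with a letter. -/
def consBit (b : Bool) (f : ℕ → Bool) : ℕ → Bool
  | 0 => b
  | i + 1 => f i

@[simp] theorem consBit_zero (b : Bool) (f : ℕ → Bool) : consBit b f 0 = b := rfl

@[simp] theorem consBit_succ (b : Bool) (f : ℕ → Bool) (i : ℕ) : consBit b f (i + 1) = f i := rfl

theorem consBit_injective (b : Bool) : Function.Injective (consBit b) := fun _ _ h =>
  funext fun i => congrFun h (i + 1)

/-- Two infinite `0`-`1` words have no `1`s at equal or adjacent positions. -/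
def Compat (f g : ℕ → Bool) : Prop :=
  ∀ i j : ℕ, (i = j ∨ i + 1 = j ∨ j + 1 = i) → ¬(f i = true ∧ g j = true)

theorem compat_consBit {a b : Bool} {f g : ℕ → Bool} :
    Compat (consBit a f) (consBit b g) ↔
      ¬(a = true ∧ b = true) ∧ ¬(a = true ∧ g 0 = true) ∧ ¬(f 0 = true ∧ b = true) ∧
        Compat f g := by
  refine ⟨fun h => ⟨h 0 0 (by simp), h 0 1 (by simp), h 1 0 (by simp), fun i j hij =>
    h (i + 1) (j + 1) (by omega)⟩, ?_⟩
  rintro ⟨h1, h2, h3, h4⟩ i j hij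
  match i, j with
  | 0, 0 => exact h1
  | 0, j + 1 =>
    have : j = 0 := by omega
    subst this
    exact h2
  | i + 1, 0 =>
    have : i = 0 := by omega
    subst this
    exact h3
  | i + 1, j + 1 => exact h4 i j (by omega)

theorem compat_comm {f g : ℕ → Bool} : Compat f g ↔ Compat g f := by
  constructor <;>
  · intro h i j hij hfg
    exact h j i (by omega) hfg.symm

namespace FibWord

/-- The letters of a word, continued by zeros. -/
def bits : (n : ℕ) → FibWord n → ℕ → Bool
  | 0, _ => fun _ => false
  | 1, _ => fun _ => false
  | n + 2, Sum.inl w => consBit false (bits (n + 1) w)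
  | n + 2, Sum.inr w => consBit true (consBit false (bits n w))

@[simp] theorem bits_inl {n : ℕ} (w : FibWord (n + 1)) :
    bits (n + 2) (Sum.inl w) = consBit false (bits (n + 1) w) := rfl

@[simp] theorem bits_inr {n : ℕ} (w : FibWord n) :
    bits (n + 2) (Sum.inr w) = consBit true (consBit false (bits n w)) := rfl

theorem bits_injective : ∀ n : ℕ, Function.Injective (bits n)
  | 0 => fun _ _ _ => rfl
  | 1 => fun _ _ _ => rfl
  | n + 2 => by
    rintro (u | u) (v | v) h
    · exact congrArg Sum.inl (bits_injective (n + 1) (consBit_injective _ h))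
    · exact absurd (congrFun h 0) (by simp)
    · exact absurd (congrFun h 0) (by simp)
    · exact congrArg Sum.inr (bits_injective n (consBit_injective _ (consBit_injective _ h)))

theorem add_one_lt_of_bits : ∀ {n : ℕ} {w : FibWord n} {i : ℕ}, bits n w i = true → i + 1 < n
  | 0, _, _, h => absurd h (by simp [bits])
  | 1, _, _, h => absurd h (by simp [bits])
  | n + 2, Sum.inl w, 0, h => by simp
  | n + 2, Sum.inl w, i + 1, h => by
    have := add_one_lt_of_bits (n := n + 1) (w := w) (i := i) h
    omega
  | n + 2, Sum.inr w, 0, h => by simp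
  | n + 2, Sum.inr w, 1, h => absurd h (by simp)
  | n + 2, Sum.inr w, i + 2, h => by
    have := add_one_lt_of_bits (n := n) (w := w) (i := i) h
    omega

theorem not_bits_and_bits_succ :
    ∀ {n : ℕ} {w : FibWord n} (i : ℕ), ¬(bits n w i = true ∧ bits n w (i + 1) = true)
  | 0, _, _ => by simp [bits]
  | 1, _, _ => by simp [bits]
  | n + 2, Sum.inl w, 0 => by simp
  | n + 2, Sum.inl w, i + 1 => not_bits_and_bits_succ (n := n + 1) (w := w) i
  | n + 2, Sum.inr w, 0 => by simp
  | n + 2, Sum.inr w, 1 => by simp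
  | n + 2, Sum.inr w, i + 2 => not_bits_and_bits_succ (n := n) (w := w) i

theorem exists_bits_eq : ∀ {n : ℕ} {f : ℕ → Bool}, (∀ i, f i = true → i + 1 < n) →
    (∀ i, ¬(f i = true ∧ f (i + 1) = true)) → ∃ w : FibWord n, bits n w = f
  | 0, f, h, _ => ⟨(), funext fun i => (Bool.eq_false_iff.2 fun hi => by
      have := h i hi
      omega).symm⟩
  | 1, f, h, _ => ⟨(), funext fun i => (Bool.eq_false_iff.2 fun hi => by
      have := h i hi
      omega).symm⟩
  | n + 2, f, h, h2 => by
    rcases h0 : f 0 with _ | _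
    · obtain ⟨w, hw⟩ := exists_bits_eq (n := n + 1) (f := fun i => f (i + 1))
        (fun i hi => by have := h _ hi; omega) fun i => h2 (i + 1)
      refine ⟨Sum.inl w, funext fun i => ?_⟩
      match i with
      | 0 => exact h0.symm
      | i + 1 => exact congrFun hw i
    · obtain ⟨w, hw⟩ := exists_bits_eq (n := n) (f := fun i => f (i + 2))
        (fun i hi => by have := h _ hi; omega) fun i => h2 (i + 2)
      refine ⟨Sum.inr w, funext fun i => ?_⟩
      match i with
      | 0 => exact h0.symm
      | 1 => exact (Bool.eq_false_iff.2 fun h1 => h2 0 ⟨h0, h1⟩).symm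
      | i + 2 => exact congrFun hw i

/-- Prefix a word with `0`; the empty word and the word `0` are both represented by the unit, and
the former becomes the latter. -/
def zeroCons : (n : ℕ) → FibWord n → FibWord (n + 1)
  | 0, w => w
  | _ + 1, w => Sum.inl w

theorem bits_zeroCons : ∀ {n : ℕ} (w : FibWord n),
    bits (n + 1) (zeroCons n w) = consBit false (bits n w)
  | 0, _ => funext fun i => by cases i <;> rfl
  | _ + 1, _ => rfl

theorem zeroCons_injective (n : ℕ) : Function.Injective (zeroCons n) := fun u v h => by
  have := congrArg (bits (n + 1)) h
  rw [bits_zeroCons, bits_zeroCons] at this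
  exact bits_injective n (consBit_injective _ this)

theorem exists_zeroCons_eq_or : ∀ {n : ℕ} (u : FibWord (n + 1)),
    (∃ t, zeroCons n t = u) ∨ bits (n + 1) u 0 = true
  | 0, u => Or.inl ⟨u, rfl⟩
  | _ + 1, Sum.inl u => Or.inl ⟨u, rfl⟩
  | _ + 1, Sum.inr _ => Or.inr rfl

theorem sum_eq_sum_zeroCons : ∀ {n : ℕ} (F : FibWord (n + 1) → ℕ),
    (∀ v, bits (n + 1) v 0 = true → F v = 0) → ∑ v, F v = ∑ t, F (zeroCons n t)
  | 0, F, _ => by rw [sum_zero, sum_one]; rfl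
  | n + 1, F, h => by
    rw [sum_add_two, Finset.sum_eq_zero (s := (Finset.univ : Finset (FibWord n)))
      fun w _ => h (Sum.inr w) rfl]
    rfl

/-- Append `0` to a word; the letters, continued by zeros, stay the same. -/
def zeroSnoc : (n : ℕ) → FibWord n → FibWord (n + 1)
  | 0, w => w
  | 1, w => Sum.inl w
  | n + 2, Sum.inl w => Sum.inl (zeroSnoc (n + 1) w)
  | n + 2, Sum.inr w => Sum.inr (zeroSnoc n w)

theorem bits_zeroSnoc : ∀ {n : ℕ} (w : FibWord n), bits (n + 1) (zeroSnoc n w) = bits n w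
  | 0, _ => rfl
  | 1, _ => funext fun i => by cases i <;> rfl
  | n + 2, Sum.inl w => congrArg (consBit false) (bits_zeroSnoc (n := n + 1) w)
  | n + 2, Sum.inr w =>
    congrArg (fun f => consBit true (consBit false f)) (bits_zeroSnoc (n := n) w)

theorem zeroSnoc_injective (n : ℕ) : Function.Injective (zeroSnoc n) := fun u v h => by
  have := congrArg (bits (n + 1)) h
  rw [bits_zeroSnoc, bits_zeroSnoc] at this
  exact bits_injective n this

theorem exists_zeroSnoc_eq_or {n : ℕ} (u : FibWord (n + 1)) :
    (∃ t, zeroSnoc n t = u) ∨ ∃ i, i + 1 = n ∧ bits (n + 1) u i = true := by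
  by_cases h : ∃ i, i + 1 = n ∧ bits (n + 1) u i = true
  · exact Or.inr h
  · obtain ⟨t, ht⟩ := exists_bits_eq (n := n) (f := bits (n + 1) u) (fun i hi => by
      have := add_one_lt_of_bits hi
      have : i + 1 ≠ n := fun h' => h ⟨i, h', hi⟩
      omega) not_bits_and_bits_succ
    exact Or.inl ⟨t, bits_injective _ (by rw [bits_zeroSnoc, ht])⟩

end FibWord

/-! ### Transfer operators on nested pairs -/

/-- Natural-number vectors indexed by `FibWord n`, stored as nested pairs. -/
abbrev FibVec : ℕ → Type
  | 0 => ℕ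
  | 1 => ℕ
  | n + 2 => FibVec (n + 1) × FibVec n

namespace FibVec

/-- The entry of a vector at a word. -/
def eval : (n : ℕ) → FibVec n → FibWord n → ℕ
  | 0, x, _ => x
  | 1, x, _ => x
  | n + 2, x, Sum.inl w => eval (n + 1) x.1 w
  | n + 2, x, Sum.inr w => eval n x.2 w

/-- The constant vector. -/
def const (a : ℕ) : (n : ℕ) → FibVec n
  | 0 => a
  | 1 => a
  | n + 2 => (const a (n + 1), const a n)

/-- The restriction of a vector to the words beginning with `0`, indexed by the rest of the word. -/
def head : (n : ℕ) → FibVec n → FibVec (n - 1)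
  | 0, x => x
  | 1, x => x
  | _ + 2, x => x.1

/-- The restriction of a vector to the words ending in `00`, the last `0` being dropped. -/
def init : (n : ℕ) → FibVec (n + 1) → FibVec n
  | 0, x => x
  | 1, x => x.1
  | n + 2, x => (init (n + 1) x.1, init n x.2)

/-- The extension by zero along `FibWord.zeroSnoc`. -/
def padEnd : (n : ℕ) → FibVec n → FibVec (n + 1)
  | 0, x => x
  | 1, x => (x, 0)
  | n + 2, x => (padEnd (n + 1) x.1, padEnd n x.2)

theorem eval_head : ∀ {n : ℕ} (x : FibVec (n + 1)) (w : FibWord n),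
    eval n (head (n + 1) x) w = eval (n + 1) x (FibWord.zeroCons n w)
  | 0, _, _ => rfl
  | _ + 1, _, _ => rfl

theorem eval_init : ∀ {n : ℕ} (x : FibVec (n + 1)) (w : FibWord n),
    eval n (init n x) w = eval (n + 1) x (FibWord.zeroSnoc n w)
  | 0, _, _ => rfl
  | 1, _, _ => rfl
  | n + 2, x, Sum.inl w => eval_init (n := n + 1) x.1 w
  | n + 2, x, Sum.inr w => eval_init (n := n) x.2 w

theorem eval_padEnd_zeroSnoc : ∀ {n : ℕ} (x : FibVec n) (w : FibWord n),
    eval (n + 1) (padEnd n x) (FibWord.zeroSnoc n w) = eval n x w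
  | 0, _, _ => rfl
  | 1, _, _ => rfl
  | n + 2, x, Sum.inl w => eval_padEnd_zeroSnoc (n := n + 1) x.1 w
  | n + 2, x, Sum.inr w => eval_padEnd_zeroSnoc (n := n) x.2 w

theorem eval_padEnd_eq_zero : ∀ {n : ℕ} (x : FibVec n) (u : FibWord (n + 1)),
    (∃ i, i + 1 = n ∧ FibWord.bits (n + 1) u i = true) → eval (n + 1) (padEnd n x) u = 0
  | 0, _, _, ⟨i, hi, _⟩ => by omega
  | 1, x, Sum.inl w, ⟨i, hi, h⟩ => by
    obtain rfl : i = 0 := by omega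
    exact absurd h (by simp)
  | 1, x, Sum.inr w, _ => rfl
  | n + 2, x, Sum.inl w, ⟨0, hi, h⟩ => absurd h (by simp)
  | n + 2, x, Sum.inl w, ⟨i + 1, hi, h⟩ =>
    eval_padEnd_eq_zero (n := n + 1) x.1 w ⟨i, by omega, h⟩
  | n + 2, x, Sum.inr w, ⟨0, hi, h⟩ => by
    omega
  | n + 2, x, Sum.inr w, ⟨1, hi, h⟩ => absurd h (by simp)
  | n + 2, x, Sum.inr w, ⟨i + 2, hi, h⟩ =>
    eval_padEnd_eq_zero (n := n) x.2 w ⟨i, by omega, h⟩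

/-- Pass `x` to the continuation `k`. Recursion on `x` makes the kernel evaluate `x` to a numeral
first, so that the continuation never copies an unevaluated term. -/
def forceNat {α : Type} (x : ℕ) (k : ℕ → α) : α :=
  Nat.rec (k 0) (fun m _ => k (Nat.succ m)) x

theorem forceNat_eq {α : Type} (x : ℕ) (k : ℕ → α) : forceNat x k = k x := by
  cases x <;> rfl

/-- Addition of vectors in continuation-passing style, for two consecutive lengths at once. The
explicit recursor keeps the kernel reduction short. -/
def addPair {α : Type} (n : ℕ) :
    (FibVec n → FibVec n → (FibVec n → α) → α) ×
      (FibVec (n + 1) → FibVec (n + 1) → (FibVec (n + 1) → α) → α) :=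
  Nat.rec (motive := fun n => (FibVec n → FibVec n → (FibVec n → α) → α) ×
      (FibVec (n + 1) → FibVec (n + 1) → (FibVec (n + 1) → α) → α))
    (fun x y k => forceNat (Nat.add x y) k, fun x y k => forceNat (Nat.add x y) k)
    (fun _ ih => (ih.2, fun x y k => ih.2 x.1 y.1 fun a => ih.1 x.2 y.2 fun b => k (a, b))) n

/-- Addition of vectors in continuation-passing style. -/
def addThen {α : Type} (n : ℕ) : FibVec n → FibVec n → (FibVec n → α) → α := (addPair n).1

theorem addThen_spec {α : Type} : ∀ {n : ℕ} (x y : FibVec n),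
    ∃ z, (∀ w, eval n z w = eval n x w + eval n y w) ∧
      ∀ k : FibVec n → α, addThen n x y k = k z
  | 0, x, y => ⟨Nat.add x y, fun _ => rfl, fun k => forceNat_eq _ k⟩
  | 1, x, y => ⟨Nat.add x y, fun _ => rfl, fun k => forceNat_eq _ k⟩
  | n + 2, x, y => by
    obtain ⟨a, ha, ha'⟩ := addThen_spec (α := α) (n := n + 1) x.1 y.1
    obtain ⟨b, hb, hb'⟩ := addThen_spec (α := α) (n := n) x.2 y.2
    refine ⟨(a, b), ?_, fun k => ?_⟩
    · rintro (w | w)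
      · exact ha w
      · exact hb w
    · exact (ha' _).trans (hb' _)

/-- Add a vector to the entries at the words beginning with `0`, in continuation-passing style. -/
def addHeadThen {α : Type} (n : ℕ) :
    FibVec (n + 1) → FibVec n → (FibVec (n + 1) → α) → α :=
  Nat.rec (motive := fun n => FibVec (n + 1) → FibVec n → (FibVec (n + 1) → α) → α)
    (fun x y k => addThen 0 x y k)
    (fun n _ x y k => addThen (n + 1) x.1 y fun a => k (a, x.2)) n

theorem addHeadThen_spec {α : Type} : ∀ {n : ℕ} (x : FibVec (n + 1)) (y : FibVec n),
    ∃ z, (∀ t, eval (n + 1) z (FibWord.zeroCons n t) =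
        eval (n + 1) x (FibWord.zeroCons n t) + eval n y t) ∧
      (∀ u, FibWord.bits (n + 1) u 0 = true → eval (n + 1) z u = eval (n + 1) x u) ∧
      ∀ k : FibVec (n + 1) → α, addHeadThen n x y k = k z
  | 0, x, y => by
    obtain ⟨z, hz, hz'⟩ := addThen_spec (α := α) (n := 0) x y
    exact ⟨z, hz, fun u hu => absurd hu (by simp [FibWord.bits]), hz'⟩
  | n + 1, x, y => by
    obtain ⟨z, hz, hz'⟩ := addThen_spec (α := α) (n := n + 1) x.1 y
    refine ⟨(z, x.2), hz, ?_, fun k => hz' _⟩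
    rintro (u | u) hu
    · exact absurd hu (by simp)
    · rfl

open Classical in
/-- `y` is the product of `x` with the 0-1 matrix of the relation `Compat`. -/
def IsTransfer (n : ℕ) (x y : FibVec n) : Prop :=
  ∀ u, eval n y u = ∑ v, if Compat (FibWord.bits n u) (FibWord.bits n v) then eval n x v else 0

theorem isTransfer_zero (x : FibVec 0) : IsTransfer 0 x x := fun u => by
  rw [FibWord.sum_zero, if_pos (by simp [Compat, FibWord.bits])]
  rfl

theorem isTransfer_one (x : FibVec 1) : IsTransfer 1 x x := fun u => by
  rw [FibWord.sum_one, if_pos (by simp [Compat, FibWord.bits])]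
  rfl

open Classical in
/-- The product with the matrix of `Compat`, split along the beginnings `0` and `10` of both words:
`0u` and `10v` are compatible iff `u` begins with `0` and its rest is compatible with `v`, while
`10u` and `10v` never are. -/
theorem isTransfer_add_two {n : ℕ} {x : FibVec (n + 2)} {p s : FibVec (n + 1)} {q r : FibVec n}
    (hp : IsTransfer (n + 1) x.1 p) (hq : IsTransfer n (head (n + 1) x.1) q)
    (hr : IsTransfer n x.2 r)
    (hs : ∀ t, eval (n + 1) s (FibWord.zeroCons n t) =
      eval (n + 1) p (FibWord.zeroCons n t) + eval n r t)
    (hs' : ∀ u, FibWord.bits (n + 1) u 0 = true → eval (n + 1) s u = eval (n + 1) p u) :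
    IsTransfer (n + 2) x (s, q) := by
  rintro (u | u)
  · rw [FibWord.sum_add_two]
    have h1 : eval (n + 2) (s, q) (Sum.inl u) = eval (n + 1) s u := rfl
    rw [h1]
    have h2 : eval (n + 1) p u = ∑ v : FibWord (n + 1), if
        Compat (FibWord.bits (n + 2) (Sum.inl u)) (FibWord.bits (n + 2) (Sum.inl v)) then
          eval (n + 2) x (Sum.inl v) else 0 := by
      rw [hp u]
      refine Finset.sum_congr rfl fun v _ => if_congr ?_ rfl rfl
      simp [compat_consBit]
    rcases FibWord.exists_zeroCons_eq_or u with ⟨t, rfl⟩ | hu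
    · rw [hs t, h2, hr t]
      congr 1
      refine Finset.sum_congr rfl fun v _ => if_congr ?_ rfl rfl
      simp [FibWord.bits_zeroCons, compat_consBit]
    · rw [hs' u hu, h2, left_eq_add]
      refine Finset.sum_eq_zero fun v _ => if_neg ?_
      simp [compat_consBit, hu]
  · have h0 : ∀ v : FibWord n, (if Compat (FibWord.bits (n + 2) (Sum.inr u))
        (FibWord.bits (n + 2) (Sum.inr v)) then eval (n + 2) x (Sum.inr v) else 0) = 0 :=
      fun v => if_neg (by simp [compat_consBit])
    rw [FibWord.sum_add_two]
    simp only [h0, Finset.sum_const_zero, add_zero]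
    rw [FibWord.sum_eq_sum_zeroCons]
    · refine (hq u).trans (Finset.sum_congr rfl fun v _ => if_congr ?_ (eval_head _ _) rfl)
      simp [FibWord.bits_zeroCons, compat_consBit]
    · intro v hv
      exact if_neg (by simp [compat_consBit, hv])

/-- The product with the matrix of `Compat`, together with the product of the restriction `head`,
for two consecutive lengths at once and in continuation-passing style. -/
def transferPair {α : Type} (n : ℕ) :
    (FibVec n → (FibVec n → FibVec (n - 1) → α) → α) ×
      (FibVec (n + 1) → (FibVec (n + 1) → FibVec n → α) → α) :=
  Nat.rec (motive := fun n => (FibVec n → (FibVec n → FibVec (n - 1) → α) → α) ×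
      (FibVec (n + 1) → (FibVec (n + 1) → FibVec n → α) → α))
    (fun x k => k x x, fun x k => k x x)
    (fun n ih => (ih.2, fun x k => ih.2 x.1 fun p q => ih.1 x.2 fun r _ =>
      addHeadThen n p r fun s => k (s, q) p)) n

/-- The product with the matrix of `Compat`, together with the product of the restriction `head`, in
continuation-passing style. -/
def transferThen {α : Type} (n : ℕ) : FibVec n → (FibVec n → FibVec (n - 1) → α) → α :=
  (transferPair n).1

theorem transferThen_spec {α : Type} : ∀ {n : ℕ} (x : FibVec n),
    ∃ y z, IsTransfer n x y ∧ IsTransfer (n - 1) (head n x) z ∧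
      ∀ k : FibVec n → FibVec (n - 1) → α, transferThen n x k = k y z
  | 0, x => ⟨x, x, isTransfer_zero x, isTransfer_zero x, fun _ => rfl⟩
  | 1, x => ⟨x, x, isTransfer_one x, isTransfer_zero x, fun _ => rfl⟩
  | n + 2, x => by
    obtain ⟨p, q, hp, hq, hpq⟩ := transferThen_spec (α := α) (n := n + 1) x.1
    obtain ⟨r, _, hr, -, hr'⟩ := transferThen_spec (α := α) (n := n) x.2
    obtain ⟨s, hs, hs', hs''⟩ := addHeadThen_spec (α := α) p r
    exact ⟨(s, q), p, isTransfer_add_two hp hq hr hs hs', hp,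
      fun k => (hpq _).trans ((hr' _).trans (hs'' _))⟩

/-- All entries of `x` are positive, and those of `y` lie between `a / s` and `b / s` times those of
`x`. -/
def ratioTest (a b s : ℕ) : (n : ℕ) → FibVec n → FibVec n → Bool
  | 0, x, y => Nat.ble 1 x && Nat.ble (Nat.mul a x) (Nat.mul s y) &&
      Nat.ble (Nat.mul s y) (Nat.mul b x)
  | 1, x, y => Nat.ble 1 x && Nat.ble (Nat.mul a x) (Nat.mul s y) &&
      Nat.ble (Nat.mul s y) (Nat.mul b x)
  | n + 2, x, y => ratioTest a b s (n + 1) x.1 y.1 && ratioTest a b s n x.2 y.2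

theorem of_ratioTest {a b s : ℕ} : ∀ {n : ℕ} {x y : FibVec n}, ratioTest a b s n x y = true →
    ∀ w, 0 < eval n x w ∧ a * eval n x w ≤ s * eval n y w ∧ s * eval n y w ≤ b * eval n x w
  | 0, x, y, h, _ => by
    simp only [ratioTest, Bool.and_eq_true, Nat.ble_eq] at h
    exact ⟨h.1.1, h.1.2, h.2⟩
  | 1, x, y, h, _ => by
    simp only [ratioTest, Bool.and_eq_true, Nat.ble_eq] at h
    exact ⟨h.1.1, h.1.2, h.2⟩
  | n + 2, x, y, h, Sum.inl w =>
    of_ratioTest (n := n + 1) (Bool.and_eq_true _ _ ▸ h : _ ∧ _).1 w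
  | n + 2, x, y, h, Sum.inr w =>
    of_ratioTest (n := n) (Bool.and_eq_true _ _ ▸ h : _ ∧ _).2 w

/-- Power iteration: apply the matrix of `Compat` `j` times to `x`, then compare the result with its
next image. -/
def powerTest (a b s n : ℕ) : ℕ → FibVec n → Bool
  | 0, x => transferThen n x fun y _ => ratioTest a b s n x y
  | j + 1, x => transferThen n x fun y _ => powerTest a b s n j y

theorem exists_of_powerTest {a b s n : ℕ} : ∀ {j : ℕ} {x : FibVec n},
    powerTest a b s n j x = true →
      ∃ x y, IsTransfer n x y ∧ ratioTest a b s n x y = true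
  | 0, x, h => by
    obtain ⟨y, z, hy, -, hk⟩ := transferThen_spec (α := Bool) x
    rw [powerTest, hk] at h
    exact ⟨x, y, hy, h⟩
  | j + 1, x, h => by
    obtain ⟨y, z, hy, -, hk⟩ := transferThen_spec (α := Bool) x
    rw [powerTest, hk] at h
    exact exists_of_powerTest h

end FibVec

/-- Entrywise bounds on the ratio of a positive test vector and its image, in natural numbers,
enclose the eigenvalue of a positive eigenvector. -/
theorem eigenvalue_mem_Icc_of_nat_test {ι κ : Type*} [Fintype ι] [Fintype κ] [Nonempty ι]
    {A : Matrix ι ι ℝ}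
    {w : ι → ℝ} {c : ℝ} (hA : A.IsSymm) (hw : ∀ i, 0 < w i) (h : A *ᵥ w = c • w) (e : κ ≃ ι)
    {X Y : κ → ℕ} (hY : ∀ u, (Y u : ℝ) = ∑ v, A (e u) (e v) * X v) {a b s : ℕ} (hs : 0 < s)
    (hXY : ∀ u, 0 < X u ∧ a * X u ≤ s * Y u ∧ s * Y u ≤ b * X u) :
    c ∈ Set.Icc ((a : ℝ) / s) ((b : ℝ) / s) := by
  have hs' : (0 : ℝ) < s := by exact_mod_cast hs
  have hmul : ∀ i, (A *ᵥ fun i => (X (e.symm i) : ℝ)) i = Y (e.symm i) := by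
    intro i
    rw [hY, Matrix.mulVec, dotProduct, ← e.sum_comp]
    simp
  have hpos : ∀ i, (0 : ℝ) < X (e.symm i) := fun i => by exact_mod_cast (hXY _).1
  refine eigenvalue_mem_Icc_of_mulVec_bounds hA hw h (x := fun i => (X (e.symm i) : ℝ))
    (fun i => (hpos i).le) ⟨Classical.arbitrary ι, hpos _⟩ (fun i => ?_) fun i => ?_
  · rw [hmul, div_mul_eq_mul_div, div_le_iff₀ hs', mul_comm (Y _ : ℝ)]
    exact_mod_cast (hXY (e.symm i)).2.1
  · rw [hmul, div_mul_eq_mul_div, le_div_iff₀ hs', mul_comm (Y _ : ℝ)]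
    exact_mod_cast (hXY (e.symm i)).2.2

/-! ### The transfer matrices on Fibonacci words -/

/-- The vectors indexing `transferT m` are the Fibonacci words of length `m + 2` without their
final `0`. -/
noncomputable def pathVecEquiv (m : ℕ) : FibWord (m + 2) ≃ PathVec m :=
  Equiv.ofBijective
    (fun w => ⟨fun i => FibWord.bits (m + 2) w i, fun i j hij h => by
      simp only [← hij] at h
      exact FibWord.not_bits_and_bits_succ _ h⟩) <| by
    constructor
    · intro u v h
      refine FibWord.bits_injective _ (funext fun i => ?_)
      by_cases hi : i < m + 1
      · exact congrFun (congrArg Subtype.val h) ⟨i, hi⟩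
      · have : ∀ w : FibWord (m + 2), FibWord.bits (m + 2) w i = false := fun w =>
          Bool.eq_false_iff.2 fun hw => hi (by
            have := FibWord.add_one_lt_of_bits hw
            omega)
        rw [this, this]
    · intro v
      obtain ⟨w, hw⟩ := FibWord.exists_bits_eq (n := m + 2)
        (f := fun i => if h : i < m + 1 then v.1 ⟨i, h⟩ else false)
        (fun i hi => by
          by_contra hlt
          rw [dif_neg (by omega)] at hi
          exact Bool.false_ne_true hi)
        (fun i => by
          by_cases hi : i + 1 < m + 1
          · rw [dif_pos hi, dif_pos (by omega)]
            exact v.2 _ _ rfl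
          · simp [hi])
      refine ⟨w, Subtype.ext (funext fun i => ?_)⟩
      simp only [hw]
      exact dif_pos i.2

open Classical in
theorem transferT_pathVecEquiv (m : ℕ) (u v : FibWord (m + 2)) :
    transferT m (pathVecEquiv m u) (pathVecEquiv m v) =
      if Compat (FibWord.bits (m + 2) u) (FibWord.bits (m + 2) v) then 1 else 0 := by
  rw [transferT_apply]
  refine if_congr ⟨fun h i j hij hb => ?_, fun h i j hij => h i j hij⟩ rfl rfl
  have hi := FibWord.add_one_lt_of_bits hb.1
  have hj := FibWord.add_one_lt_of_bits hb.2
  exact h ⟨i, by omega⟩ ⟨j, by omega⟩ hij hb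

theorem lam_mem_Icc_of_powerTest {a b s m j : ℕ} (hs : 0 < s)
    (h : FibVec.powerTest a b s (m + 2) j (FibVec.const 1 (m + 2)) = true) :
    lam m ∈ Set.Icc ((a : ℝ) / s) ((b : ℝ) / s) := by
  obtain ⟨x, y, hxy, ht⟩ := FibVec.exists_of_powerTest h
  obtain ⟨-, w, hw, hAw⟩ := lam_pos_and_exists_eigenvector m
  refine eigenvalue_mem_Icc_of_nat_test (transferT_isSymm m) hw hAw (pathVecEquiv m)
    (X := FibVec.eval (m + 2) x) (Y := FibVec.eval (m + 2) y) (fun u => ?_) hs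
    (FibVec.of_ratioTest ht)
  rw [hxy u, Nat.cast_sum]
  refine Finset.sum_congr rfl fun v _ => ?_
  rw [transferT_pathVecEquiv]
  split_ifs <;> simp

/-- The cyclic words of length `k + 2`: a Fibonacci word `w` of length `k + 2` stands for `0w` with
the final `0` dropped, and one of length `k` for `10w`. -/
abbrev CycleWord (k : ℕ) : Type := FibWord (k + 2) ⊕ FibWord k

/-- The letters of a cyclic word, continued by zeros. -/
def cycleBits (k : ℕ) : CycleWord k → ℕ → Bool
  | Sum.inl w => consBit false (FibWord.bits (k + 2) w)
  | Sum.inr w => consBit true (consBit false (FibWord.bits k w))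

theorem cycleBits_injective (k : ℕ) : Function.Injective (cycleBits k) := by
  rintro (u | u) (v | v) h
  · exact congrArg Sum.inl (FibWord.bits_injective _ (consBit_injective _ h))
  · exact absurd (congrFun h 0) (by simp [cycleBits])
  · exact absurd (congrFun h 0) (by simp [cycleBits])
  · exact congrArg Sum.inr
      (FibWord.bits_injective _ (consBit_injective _ (consBit_injective _ h)))

theorem lt_of_cycleBits {k : ℕ} : ∀ {w : CycleWord k} {i : ℕ}, cycleBits k w i = true → i < k + 2
  | _, 0, _ => by omega
  | Sum.inl w, i + 1, h => by
    have := FibWord.add_one_lt_of_bits (w := w) (i := i) h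
    omega
  | Sum.inr w, 1, h => by omega
  | Sum.inr w, i + 2, h => by
    have := FibWord.add_one_lt_of_bits (w := w) (i := i) h
    omega

/-- Compatibility of cyclic words: besides the linear condition, the first and the last position
are adjacent. -/
def CyclicCompat (k : ℕ) (f g : ℕ → Bool) : Prop :=
  Compat f g ∧ ¬(f 0 = true ∧ g (k + 1) = true) ∧ ¬(f (k + 1) = true ∧ g 0 = true)

theorem add_one_mod_eq_iff {k i j : ℕ} (hi : i < k + 2) (hj : j < k + 2) :
    (i + 1) % (k + 2) = j ↔ i + 1 = j ∨ (i = k + 1 ∧ j = 0) := by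
  rcases Nat.lt_or_ge (i + 1) (k + 2) with h | h
  · rw [Nat.mod_eq_of_lt h]
    omega
  · have : i = k + 1 := by omega
    subst this
    rw [Nat.mod_self]
    omega

theorem cycleBits_succ_of_mod {k : ℕ} : ∀ {w : CycleWord k} {i j : ℕ}, i < k + 2 → j < k + 2 →
    (i + 1) % (k + 2) = j → ¬(cycleBits k w i = true ∧ cycleBits k w j = true) := by
  intro w i j hi hj hij h
  rcases (add_one_mod_eq_iff hi hj).1 hij with rfl | ⟨rfl, rfl⟩
  · match w, i with
    | Sum.inl w, 0 => simp [cycleBits] at h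
    | Sum.inl w, i + 1 => exact FibWord.not_bits_and_bits_succ (w := w) i h
    | Sum.inr w, 0 => simp [cycleBits] at h
    | Sum.inr w, 1 => simp [cycleBits] at h
    | Sum.inr w, i + 2 => exact FibWord.not_bits_and_bits_succ (w := w) i h
  · rcases w with w | w
    · simp [cycleBits] at h
    · cases k with
      | zero => simp [cycleBits] at h
      | succ k =>
        have := FibWord.add_one_lt_of_bits (w := w) (i := k) h.1
        omega

theorem exists_cycleBits_eq {k : ℕ} {f : ℕ → Bool} (h1 : ∀ i, f i = true → i < k + 2)
    (h2 : ∀ i, ¬(f i = true ∧ f (i + 1) = true)) (h3 : ¬(f (k + 1) = true ∧ f 0 = true)) :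
    ∃ w : CycleWord k, cycleBits k w = f := by
  rcases h0 : f 0 with _ | _
  · obtain ⟨w, hw⟩ := FibWord.exists_bits_eq (n := k + 2) (f := fun i => f (i + 1))
      (fun i hi => h1 _ hi) fun i => h2 (i + 1)
    refine ⟨Sum.inl w, funext fun i => ?_⟩
    match i with
    | 0 => exact h0.symm
    | i + 1 => exact congrFun hw i
  · obtain ⟨w, hw⟩ := FibWord.exists_bits_eq (n := k) (f := fun i => f (i + 2))
      (fun i hi => by
        have := h1 _ hi
        have : i + 2 ≠ k + 1 := fun h => h3 ⟨h ▸ hi, h0⟩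
        omega) fun i => h2 (i + 2)
    refine ⟨Sum.inr w, funext fun i => ?_⟩
    match i with
    | 0 => exact h0.symm
    | 1 => exact (Bool.eq_false_iff.2 fun h => h2 0 ⟨h0, h⟩).symm
    | i + 2 => exact congrFun hw i

/-- The vectors indexing `transferB (k + 2)` are the cyclic words of length `k + 2`. -/
noncomputable def cycleVecEquiv (k : ℕ) : CycleWord k ≃ CycleVec (k + 2) :=
  Equiv.ofBijective
    (fun w => ⟨fun i => cycleBits k w i, fun i j hij => cycleBits_succ_of_mod i.2 j.2 hij⟩) <| by
    constructor
    · intro u v h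
      refine cycleBits_injective _ (funext fun i => ?_)
      by_cases hi : i < k + 2
      · exact congrFun (congrArg Subtype.val h) ⟨i, hi⟩
      · have : ∀ w : CycleWord k, cycleBits k w i = false := fun w =>
          Bool.eq_false_iff.2 fun hw => hi (lt_of_cycleBits hw)
        rw [this, this]
    · intro v
      obtain ⟨w, hw⟩ := exists_cycleBits_eq (k := k)
        (f := fun i => if h : i < k + 2 then v.1 ⟨i, h⟩ else false)
        (fun i hi => by
          by_contra hlt
          rw [dif_neg hlt] at hi
          exact Bool.false_ne_true hi)
        (fun i => by
          by_cases hi : i + 1 < k + 2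
          · rw [dif_pos hi, dif_pos (by omega)]
            exact v.2 _ _ (Nat.mod_eq_of_lt hi)
          · simp [hi])
        (by
          rw [dif_pos (by omega), dif_pos (by omega)]
          exact v.2 _ _ (Nat.mod_self _))
      refine ⟨w, Subtype.ext (funext fun i => ?_)⟩
      simp only [hw]
      exact dif_pos i.2

open Classical in
theorem transferB_cycleVecEquiv (k : ℕ) (u v : CycleWord k) :
    transferB (k + 2) (cycleVecEquiv k u) (cycleVecEquiv k v) =
      if CyclicCompat k (cycleBits k u) (cycleBits k v) then 1 else 0 := by
  rw [transferB_apply]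
  refine if_congr ⟨fun h => ⟨fun i j hij hb => ?_, ?_, ?_⟩, fun h i j hij => ?_⟩ rfl rfl
  · have hi := lt_of_cycleBits hb.1
    have hj := lt_of_cycleBits hb.2
    refine h ⟨i, hi⟩ ⟨j, hj⟩ ?_ hb
    simp only [add_one_mod_eq_iff hi hj, add_one_mod_eq_iff hj hi]
    omega
  · exact h ⟨0, by omega⟩ ⟨k + 1, by omega⟩ (Or.inr (Or.inr (Nat.mod_self _)))
  · exact h ⟨k + 1, by omega⟩ ⟨0, by omega⟩ (Or.inr (Or.inl (Nat.mod_self _)))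
  · rw [add_one_mod_eq_iff i.2 j.2, add_one_mod_eq_iff j.2 i.2] at hij
    have h0 : (i : ℕ) = j ∨ (i : ℕ) + 1 = j ∨ (j : ℕ) + 1 = i ∨
        ((i : ℕ) = k + 1 ∧ (j : ℕ) = 0) ∨ ((i : ℕ) = 0 ∧ (j : ℕ) = k + 1) := by omega
    change ¬(cycleBits k u i = true ∧ cycleBits k v j = true)
    rcases h0 with h0 | h0 | h0 | ⟨h0, h0'⟩ | ⟨h0, h0'⟩
    · exact h.1 i j (Or.inl h0)
    · exact h.1 i j (Or.inr (Or.inl h0))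
    · exact h.1 i j (Or.inr (Or.inr h0))
    · rw [h0, h0']
      exact h.2.2
    · rw [h0, h0']
      exact h.2.1

theorem cyclicCompat_inl_inl {k : ℕ} (u v : FibWord (k + 2)) :
    CyclicCompat k (cycleBits k (Sum.inl u)) (cycleBits k (Sum.inl v)) ↔
      Compat (FibWord.bits (k + 2) u) (FibWord.bits (k + 2) v) := by
  simp [CyclicCompat, cycleBits, compat_consBit]

theorem not_cyclicCompat_inr_inr {k : ℕ} (u v : FibWord k) :
    ¬CyclicCompat k (cycleBits k (Sum.inr u)) (cycleBits k (Sum.inr v)) := by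
  simp [CyclicCompat, cycleBits, compat_consBit]

theorem cyclicCompat_inl_inr {k : ℕ} (u : FibWord (k + 2)) (v : FibWord k) :
    CyclicCompat k (cycleBits k (Sum.inl u)) (cycleBits k (Sum.inr v)) ↔
      FibWord.bits (k + 2) u 0 = false ∧ FibWord.bits (k + 2) u k = false ∧
        Compat (FibWord.bits (k + 2) u) (consBit false (FibWord.bits k v)) := by
  simp [CyclicCompat, cycleBits, compat_consBit]
  tauto

theorem cyclicCompat_comm {k : ℕ} {f g : ℕ → Bool} : CyclicCompat k f g ↔ CyclicCompat k g f := by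
  simp only [CyclicCompat, compat_comm (f := f)]
  tauto

/-- The Fibonacci word `0t0` of length `k + 2`. -/
def zeroConsSnoc (k : ℕ) (t : FibWord k) : FibWord (k + 2) :=
  FibWord.zeroCons (k + 1) (FibWord.zeroSnoc k t)

theorem cyclicCompat_inl_zeroConsSnoc_inr {k : ℕ} (t v : FibWord k) :
    CyclicCompat k (cycleBits k (Sum.inl (zeroConsSnoc k t))) (cycleBits k (Sum.inr v)) ↔
      Compat (FibWord.bits k t) (FibWord.bits k v) := by
  have hk : consBit false (FibWord.bits k t) k = false := by
    refine Bool.eq_false_iff.2 fun h => ?_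
    cases k with
    | zero => exact Bool.false_ne_true h
    | succ k =>
      have := FibWord.add_one_lt_of_bits (w := t) (i := k) h
      omega
  rw [cyclicCompat_inl_inr, zeroConsSnoc, FibWord.bits_zeroCons, FibWord.bits_zeroSnoc]
  simp [compat_consBit, hk]

theorem exists_zeroConsSnoc_eq_or {k : ℕ} (u : FibWord (k + 2)) :
    (∃ t, zeroConsSnoc k t = u) ∨
      ∀ v, ¬CyclicCompat k (cycleBits k (Sum.inl u)) (cycleBits k (Sum.inr v)) := by
  rcases FibWord.exists_zeroCons_eq_or u with ⟨s, rfl⟩ | h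
  · rcases FibWord.exists_zeroSnoc_eq_or s with ⟨t, rfl⟩ | ⟨i, rfl, hi⟩
    · exact Or.inl ⟨t, rfl⟩
    · refine Or.inr fun v hv => ?_
      have := ((cyclicCompat_inl_inr _ _).1 hv).2.1
      rw [FibWord.bits_zeroCons, consBit_succ, hi] at this
      exact Bool.false_ne_true this.symm
  · refine Or.inr fun v hv => ?_
    rw [cyclicCompat_inl_inr, h] at hv
    exact Bool.false_ne_true hv.1.symm

theorem zeroConsSnoc_injective (k : ℕ) : Function.Injective (zeroConsSnoc k) :=
  (FibWord.zeroCons_injective _).comp (FibWord.zeroSnoc_injective _)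

/-- Natural-number vectors indexed by `CycleWord k`. -/
abbrev CycleFibVec (k : ℕ) : Type := FibVec (k + 2) × FibVec k

namespace CycleFibVec

/-- The entry of a vector at a cyclic word. -/
def eval (k : ℕ) (x : CycleFibVec k) : CycleWord k → ℕ
  | Sum.inl w => FibVec.eval (k + 2) x.1 w
  | Sum.inr w => FibVec.eval k x.2 w

/-- The product of a vector with the 0-1 matrix of `CyclicCompat`, in continuation-passing style. -/
def transferThen {α : Type} (k : ℕ) (x : CycleFibVec k) (c : CycleFibVec k → α) : α :=
  FibVec.transferThen (k + 2) x.1 fun p _ =>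
    FibVec.transferThen k x.2 fun r _ =>
      FibVec.transferThen k (FibVec.init k (FibVec.head (k + 2) x.1)) fun s _ =>
        FibVec.addHeadThen (k + 1) p (FibVec.padEnd k r) fun q => c (q, s)

open Classical in
theorem transferThen_spec {α : Type} {k : ℕ} (x : CycleFibVec k) :
    ∃ y, (∀ u, eval k y u =
        ∑ v, if CyclicCompat k (cycleBits k u) (cycleBits k v) then eval k x v else 0) ∧
      ∀ c : CycleFibVec k → α, transferThen k x c = c y := by
  obtain ⟨p, _, hp, -, hp'⟩ := FibVec.transferThen_spec (α := α) x.1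
  obtain ⟨r, _, hr, -, hr'⟩ := FibVec.transferThen_spec (α := α) x.2
  obtain ⟨s, _, hs, -, hs'⟩ := FibVec.transferThen_spec (α := α)
    (FibVec.init k (FibVec.head (k + 2) x.1))
  obtain ⟨q, hq, hq', hq''⟩ := FibVec.addHeadThen_spec (α := α) p (FibVec.padEnd k r)
  refine ⟨(q, s), ?_, fun c => (hp' _).trans ((hr' _).trans ((hs' _).trans (hq'' _)))⟩
  rintro (u | u)
  · rw [Fintype.sum_sum_type]
    simp only [cyclicCompat_inl_inl]
    change FibVec.eval (k + 2) q u = _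
    have hpu : (∑ v, if Compat (FibWord.bits (k + 2) u) (FibWord.bits (k + 2) v) then
        eval k x (Sum.inl v) else 0) = FibVec.eval (k + 2) p u := (hp u).symm
    rw [hpu]
    rcases exists_zeroConsSnoc_eq_or u with ⟨t, rfl⟩ | hu
    · simp only [cyclicCompat_inl_zeroConsSnoc_inr]
      rw [zeroConsSnoc, hq, FibVec.eval_padEnd_zeroSnoc, hr t]
      rfl
    · simp only [hu, if_false, Finset.sum_const_zero, add_zero]
      rcases FibWord.exists_zeroCons_eq_or u with ⟨v, rfl⟩ | h0
      · rw [hq, Nat.add_eq_left]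
        rcases FibWord.exists_zeroSnoc_eq_or v with ⟨t, rfl⟩ | hv
        · -- `0t0` is compatible with `10z` for the zero word `z`, so this case is empty
          obtain ⟨z, hz⟩ := FibWord.exists_bits_eq (n := k) (f := fun _ => false) (by simp)
            (by simp)
          exact absurd ((cyclicCompat_inl_zeroConsSnoc_inr t z).2 (by simp [hz, Compat])) (hu z)
        · exact FibVec.eval_padEnd_eq_zero _ _ hv
      · exact hq' u h0
  · rw [Fintype.sum_sum_type]
    simp only [not_cyclicCompat_inr_inr, if_false, Finset.sum_const_zero, add_zero]
    change FibVec.eval k s u = _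
    rw [hs u, ← Finset.sum_subset (Finset.subset_univ
      (Finset.univ.map ⟨zeroConsSnoc k, zeroConsSnoc_injective k⟩)), Finset.sum_map]
    · refine Finset.sum_congr rfl fun v _ => if_congr ?_ ?_ rfl
      · rw [cyclicCompat_comm, Function.Embedding.coeFn_mk, cyclicCompat_inl_zeroConsSnoc_inr,
          compat_comm]
      · rw [FibVec.eval_init, FibVec.eval_head]
        rfl
    · intro v _ hv
      rw [cyclicCompat_comm]
      refine if_neg ((exists_zeroConsSnoc_eq_or v).resolve_left ?_ u)
      rintro ⟨t, rfl⟩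
      exact hv (by simp)

/-- Power iteration with the matrix of `CyclicCompat`, as in `FibVec.powerTest`. -/
def powerTest (a b s k : ℕ) : ℕ → CycleFibVec k → Bool
  | 0, x => transferThen k x fun y =>
    FibVec.ratioTest a b s (k + 2) x.1 y.1 && FibVec.ratioTest a b s k x.2 y.2
  | j + 1, x => transferThen k x fun y => powerTest a b s k j y

open Classical in
theorem exists_of_powerTest {a b s k : ℕ} : ∀ {j : ℕ} {x : CycleFibVec k},
    powerTest a b s k j x = true →
      ∃ x y : CycleFibVec k, (∀ u, eval k y u =
        ∑ v, if CyclicCompat k (cycleBits k u) (cycleBits k v) then eval k x v else 0) ∧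
        ∀ u, 0 < eval k x u ∧ a * eval k x u ≤ s * eval k y u ∧
          s * eval k y u ≤ b * eval k x u
  | 0, x, h => by
    obtain ⟨y, hy, hk⟩ := transferThen_spec (α := Bool) x
    rw [powerTest, hk, Bool.and_eq_true] at h
    refine ⟨x, y, hy, ?_⟩
    rintro (u | u)
    · exact FibVec.of_ratioTest h.1 u
    · exact FibVec.of_ratioTest h.2 u
  | j + 1, x, h => by
    obtain ⟨y, hy, hk⟩ := transferThen_spec (α := Bool) x
    rw [powerTest, hk] at h
    exact exists_of_powerTest h

end CycleFibVec

theorem xi_mem_Icc_of_powerTest {a b s k j : ℕ} (hs : 0 < s)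
    (h : CycleFibVec.powerTest a b s k j (FibVec.const 1 (k + 2), FibVec.const 1 k) = true) :
    xi (k + 2) ∈ Set.Icc ((a : ℝ) / s) ((b : ℝ) / s) := by
  obtain ⟨x, y, hxy, ht⟩ := CycleFibVec.exists_of_powerTest h
  obtain ⟨-, w, hw, hAw⟩ := xi_pos_and_exists_eigenvector (k + 2)
  refine eigenvalue_mem_Icc_of_nat_test (transferB_isSymm (k + 2)) hw hAw (cycleVecEquiv k)
    (X := CycleFibVec.eval k x) (Y := CycleFibVec.eval k y) (fun u => ?_) hs ht
  rw [hxy u, Nat.cast_sum]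
  refine Finset.sum_congr rfl fun v _ => ?_
  rw [transferB_cycleVecEquiv]
  split_ifs <;> simp

/-! ### Numerical enclosures of the eigenvalues -/

-- Each enclosure below is obtained by enough steps of power iteration from the all-ones vector for
-- the entrywise ratios to agree to the required precision.

theorem lam_twelve_mem_Icc :
    lam 12 ∈ Set.Icc ((52764934518 : ℕ) / (1000000000 : ℕ) : ℝ)
      ((52764934550 : ℕ) / (1000000000 : ℕ)) :=
  lam_mem_Icc_of_powerTest (j := 39) (by norm_num) (by decide +kernel)

theorem lam_eight_mem_Icc :
    lam 8 ∈ Set.Icc ((162417770600 : ℕ) / (10000000000 : ℕ) : ℝ)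
      ((162417770835 : ℕ) / (10000000000 : ℕ)) :=
  lam_mem_Icc_of_powerTest (j := 38) (by norm_num) (by decide +kernel)

theorem xi_twelve_mem_Icc :
    xi 12 ∈ Set.Icc ((3432130385 : ℕ) / (100000000 : ℕ) : ℝ)
      ((3432130405 : ℕ) / (100000000 : ℕ)) :=
  xi_mem_Icc_of_powerTest (k := 10) (j := 33) (by norm_num) (by decide +kernel)

theorem rpow_one_div_mem_Ico {x a b : ℝ} {n : ℕ} (hn : n ≠ 0) (ha : 0 ≤ a) (hb : 0 ≤ b)
    (hax : a ^ n ≤ x) (hxb : x < b ^ n) : x ^ (1 / (n : ℝ)) ∈ Set.Ico a b := by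
  have hx : 0 ≤ x := (pow_nonneg ha n).trans hax
  have hn' : (0 : ℝ) < n := by exact_mod_cast Nat.pos_of_ne_zero hn
  rw [one_div]
  constructor
  · rw [Real.le_rpow_inv_iff_of_pos ha hx hn', Real.rpow_natCast]
    exact hax
  · rw [Real.rpow_inv_lt_iff_of_pos hx hb hn', Real.rpow_natCast]
    exact hxb

theorem lam_ratio_rpow_mem_Ico :
    (lam (4 + 2 * 4) / lam (2 * 4)) ^ (1 / (4 : ℝ)) ∈ Set.Ico (1.342542258 : ℝ) 1.342542259 := by
  obtain ⟨h1, h2⟩ := lam_twelve_mem_Icc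
  obtain ⟨h3, h4⟩ := lam_eight_mem_Icc
  have hpos : 0 < lam 8 := (lam_pos_and_exists_eigenvector 8).1
  have h := rpow_one_div_mem_Ico (x := lam 12 / lam 8) (a := 1.342542258) (b := 1.342542259)
    (n := 4) (by norm_num) (by norm_num) (by norm_num) ?_ ?_
  · exact_mod_cast h
  · rw [le_div_iff₀ hpos]
    push_cast at h1 h4
    refine le_trans ?_ h1
    refine (mul_le_mul_of_nonneg_left h4 (by norm_num)).trans ?_
    norm_num
  · rw [div_lt_iff₀ hpos]
    push_cast at h2 h3
    refine h2.trans_lt (lt_of_lt_of_le ?_ (mul_le_mul_of_nonneg_left h3 (by norm_num)))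
    norm_num

theorem xi_rpow_mem_Ico :
    xi (2 * 6) ^ (1 / (2 * (6 : ℝ))) ∈ Set.Ico (1.342652572 : ℝ) 1.342652573 := by
  obtain ⟨h1, h2⟩ := xi_twelve_mem_Icc
  push_cast at h1 h2
  have h := rpow_one_div_mem_Ico (x := xi 12) (a := 1.342652572) (b := 1.342652573)
    (n := 12) (by norm_num) (by norm_num) (by norm_num) (le_trans (by norm_num) h1)
    (h2.trans_lt (by norm_num))
  have e : (2 * (6 : ℝ)) = ((12 : ℕ) : ℝ) := by norm_num
  rw [e]
  exact h

end CrossedLattice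

theorem mainTheorem3 :
    ∃ η : ℝ,
      -- the entropy constants on plane, cylinder and torus exist and are equal
      Tendsto (fun k : ℕ × ℕ => CrossedLattice.indepRoot (CrossedLattice.planeCrossed k.1 k.2))
        (atTop ×ˢ atTop) (𝓝 η) ∧
      Tendsto (fun k : ℕ × ℕ => CrossedLattice.indepRoot (CrossedLattice.cylinderCrossed k.1 k.2))
        (atTop ×ˢ atTop) (𝓝 η) ∧
      Tendsto (fun k : ℕ × ℕ => CrossedLattice.indepRoot (CrossedLattice.torusCrossed k.1 k.2))
        (atTop ×ˢ atTop) (𝓝 η) ∧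
      -- the normalization by `m * n` on the plane gives the same limit
      Tendsto (fun k : ℕ × ℕ =>
          (CrossedLattice.numIndepSets (CrossedLattice.planeCrossed k.1 k.2) : ℝ) ^
            (1 / ((k.1 : ℝ) * (k.2 : ℝ))))
        (atTop ×ˢ atTop) (𝓝 η) ∧
      -- the general lower and upper bounds
      (∀ p q : ℕ, 1 ≤ p → 1 ≤ q →
        (CrossedLattice.lam (p + 2 * q) / CrossedLattice.lam (2 * q)) ^ (1 / (p : ℝ)) ≤ η) ∧
      (∀ k : ℕ, 1 ≤ k → η ≤ CrossedLattice.xi (2 * k) ^ (1 / (2 * (k : ℝ)))) ∧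
      -- the decimal expansions of the bounds for `p = q = 4` and for `k = 6`
      (CrossedLattice.lam (4 + 2 * 4) / CrossedLattice.lam (2 * 4)) ^ (1 / (4 : ℝ)) ∈
        Set.Ico (1.342542258 : ℝ) 1.342542259 ∧
      CrossedLattice.xi (2 * 6) ^ (1 / (2 * (6 : ℝ))) ∈
        Set.Ico (1.342652572 : ℝ) 1.342652573 :=
  ⟨Real.exp CrossedLattice.logEntropy, CrossedLattice.tendsto_indepRoot_planeCrossed,
    CrossedLattice.tendsto_indepRoot_cylinderCrossed,
    CrossedLattice.tendsto_indepRoot_torusCrossed,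
    by simpa using CrossedLattice.tendsto_planeCrossed_rpow 0 0,
    fun _ q hp _ => CrossedLattice.lam_div_rpow_le_exp_logEntropy q hp,
    fun _ hk => CrossedLattice.exp_logEntropy_le_xi_rpow hk,
    CrossedLattice.lam_ratio_rpow_mem_Ico, CrossedLattice.xi_rpow_mem_Ico⟩
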